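/- **Setting.** Let $\mathcal L$ be a first-order language with a binary function symbol $\cdot$ (for instance any expansion of the language of groups). Let $\mathcal L^+$ be the expansion of $\mathcal L$ by a relation symbol $[\mu_\theta\le q](\bar z)$ for every $\mathcal L$-formula $\theta(\bar x;\bar z)$ and every $q\in\mathbb Q$; in a finite $\mathcal L$-structure $A$ it is interpreted as "$|\theta(A^{\bar x};\bar z)|/|A^{\bar x}|\le q$". Let $(A_i)_{i\in I}$ be finite groups expanded to $\mathcal L$-structures in which $\cdot$ is the group operation, and let the $\mathcal L^+$-structure $G$ be an elementary extension of an ultraproduct of the (canonically expanded) $A_i$; $G$ is a group under $\cdot$. Formulas are $\mathcal L$-formulas with parameters from $G$. For $\varphi(x)=\theta(x;\bar b)$ with $\theta$ an $\mathcal L$-formula and $\bar b$ in $G$, the pseudofinite counting measure is $\mu(\varphi)=\inf\{q\in\mathbb Q: G\models[\mu_\theta\le q](\bar b)\}$. A formula $\varphi(\bar x;\bar y)$ is *NIP* if for some $k\ge1$ there are no tuples $(\bar a_i)_{i\in[k]}$, $(\bar b_X)_{X\subseteq[k]}$ from $G$ such that for all $i,X$: $G\models\varphi(\bar a_i;\bar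 b_X)$ iff $i\in X$. A formula $\varphi(x)$ is *left (right) generic* if $G$ is a union of finitely many left (right) translates of $\varphi(G)$. Given $\varphi(x)$, put $\varphi^\ell(x;y):=\varphi(y\cdot x)$; given $\delta(x;\bar y)$, put $\delta^r(x;\bar y,u):=\delta(x\cdot u;\bar y)$. The formula $\delta(x;\bar y)$ is *invariant* if for all $a,\bar b$ in $G$ there is $\bar c$ in $G$ such that $\delta(a\cdot x;\bar b)$ is equivalent to $\delta(x;\bar c)$. An *instance* of $\delta$ is a formula $\delta(x;\bar b)$ or $\neg\delta(x;\bar b)$, a *$\delta$-formula* is a finite Boolean combination of instances, and $S_\delta(G)$ is the set of complete $\delta$-types over $G$, i.e. maximal consistent sets of instances of $\delta$ (up to equivalence in $G$); a $\delta$-formula belongs to $p\in S_\delta(G)$ if it is implied by finitely many members of $p$. A type $p\in S_\delta(G)$ is *left (right) generic* if every $\delta$-formula in $p$ is left (right) generic. For $g\in G$ put $gp=\{\varphi(g^{-1}x):\varphi(x)\in p\}$ and $pg=\{\varphi(xg^{-1}):\varphi(x)\in p\}$. **Statement.** 1. Let $\varphi(x)$ be a formula such that $\varphi^\ell(x;y)$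 is NIP. Then $\varphi(x)$ is left generic iff it is right generic iff $\mu(\varphi(x))>0$. 2. Let $\delta(x;\bar y)$ be an invariant NIP formula. - (a) If $\varphi(x)$ is a $\delta^r$-formula, then $\varphi^\ell(x;y)$ is NIP; consequently $\varphi(x)$ is left generic iff it is right generic iff $\mu(\varphi(x))>0$. - (b) For every $p\in S_{\delta^r}(G)$ the following are equivalent: (i) $p$ is left generic; (ii) $p$ is right generic; (iii) $\mu(\varphi(x))>0$ for every $\delta^r$-formula $\varphi(x)\in p$. - (c) There is a generic type in $S_{\delta^r}(G)$, and there is a type in $S_\delta(G)$ that is both left and right generic. If $p\in S_{\delta^r}(G)$ is generic and $g\in G$, then $gp$ and $pg$ are generic types in $S_{\delta^r}(G)$. (By (b), "generic" may be read as left or as right generic for $\delta^r$-types.) -/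

import Mathlib

open FirstOrder

namespace PseudofiniteNIP

open FirstOrder.Language FirstOrder.Language.Structure

universe u v w w' w''

/-! ### Formulas with parameters -/

/-- A formula with parameters from `G` in the variables `α`: an `L`-formula `θ(x̄; z̄)` together
with a tuple `z̄ = par` of elements of `G`. -/
structure ParamFormula (L : FirstOrder.Language.{u, v}) (G : Type w) (α : Type) where
  /-- number of parameters -/
  n : ℕ
  /-- the underlying `L`-formula -/
  form : L.Formula (α ⊕ Fin n)
  /-- the parameters -/
  par : Fin n → G

namespace ParamFormula

variable {L : FirstOrder.Language.{u, v}} {G : Type w} {α β : Type}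

/-- Satisfaction in `G`. -/
def Holds [L.Structure G] (φ : ParamFormula L G α) (a : α → G) : Prop :=
  φ.form.Realize (Sum.elim a φ.par)

/-- The subset `φ(G)` of `G` defined by a formula `φ(x)` in one variable. -/
def set [L.Structure G] (φ : ParamFormula L G (Fin 1)) : Set G :=
  {g | φ.Holds fun _ => g}

/-- `¬ φ`. -/
def neg (φ : ParamFormula L G α) : ParamFormula L G α :=
  ⟨φ.n, φ.form.not, φ.par⟩

/-- `φ ∧ ψ`; the two parameter tuples are concatenated. -/
def conj (φ ψ : ParamFormula L G α) : ParamFormula L G α :=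
  ⟨φ.n + ψ.n,
    φ.form.relabel (Sum.map id (Fin.castAdd ψ.n)) ⊓ ψ.form.relabel (Sum.map id (Fin.natAdd φ.n)),
    Fin.append φ.par ψ.par⟩

/-- `φ ∨ ψ`. -/
def disj (φ ψ : ParamFormula L G α) : ParamFormula L G α :=
  ⟨φ.n + ψ.n,
    φ.form.relabel (Sum.map id (Fin.castAdd ψ.n)) ⊔ ψ.form.relabel (Sum.map id (Fin.natAdd φ.n)),
    Fin.append φ.par ψ.par⟩

/-- For `δ(x; ȳ)` and a tuple `b̄` from `G`, the formula `δ(x; b̄)`. -/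
def inst {k : ℕ} (δ : ParamFormula L G (α ⊕ Fin k)) (b : Fin k → G) : ParamFormula L G α :=
  ⟨k + δ.n,
    δ.form.relabel
      (Sum.elim (Sum.map id (Fin.castAdd δ.n)) (fun j => Sum.inr (Fin.natAdd k j))),
    Fin.append b δ.par⟩

/-- For `φ(x)`, the formula `φˡ(x; y) := φ(y · x)`. -/
def left (mulSym : L.Functions 2) (φ : ParamFormula L G (Fin 1)) :
    ParamFormula L G (Fin 1 ⊕ Fin 1) :=
  ⟨φ.n,
    φ.form.subst
      (Sum.elim
        (fun _ => mulSym.apply₂ (Term.var (Sum.inl (Sum.inr 0))) (Term.var (Sum.inl (Sum.inl 0))))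
        (fun j => Term.var (Sum.inr j))),
    φ.par⟩

/-- For `δ(x; ȳ)`, the formula `δʳ(x; ȳ, u) := δ(x · u; ȳ)`; `u` is the last parameter variable. -/
def right (mulSym : L.Functions 2) {k : ℕ} (δ : ParamFormula L G (Fin 1 ⊕ Fin k)) :
    ParamFormula L G (Fin 1 ⊕ Fin (k + 1)) :=
  ⟨δ.n,
    δ.form.subst
      (Sum.elim
        (Sum.elim
          (fun _ => mulSym.apply₂ (Term.var (Sum.inl (Sum.inl 0)))
            (Term.var (Sum.inl (Sum.inr (Fin.last k)))))
          (fun j => Term.var (Sum.inl (Sum.inr j.castSucc))))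
        (fun j => Term.var (Sum.inr j))),
    δ.par⟩

/-- `φ(x̄; ȳ)` is `k`-NIP. -/
def IsKNIP [L.Structure G] (k : ℕ) (φ : ParamFormula L G (α ⊕ β)) : Prop :=
  ¬ ∃ (a : Fin k → α → G) (b : Set (Fin k) → β → G),
    ∀ i X, φ.Holds (Sum.elim (a i) (b X)) ↔ i ∈ X

/-- `φ(x̄; ȳ)` is NIP. -/
def IsNIP [L.Structure G] (φ : ParamFormula L G (α ⊕ β)) : Prop :=
  ∃ k, 1 ≤ k ∧ φ.IsKNIP k

/-- `δ(x; ȳ)` is (left) invariant: each `δ(a · x; b̄)` is equivalent to some `δ(x; c̄)`. -/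
def IsLeftInvariant [Group G] [L.Structure G] {k : ℕ} (δ : ParamFormula L G (Fin 1 ⊕ Fin k)) :
    Prop :=
  ∀ (a : G) (b : Fin k → G), ∃ c : Fin k → G, ∀ x : G,
    δ.Holds (Sum.elim (fun _ => a * x) b) ↔ δ.Holds (Sum.elim (fun _ => x) c)

/-- The `δ`-formulas: finite Boolean combinations of formulas `δ(x; b̄)`. -/
inductive IsDeltaFormula {k : ℕ} (δ : ParamFormula L G (Fin 1 ⊕ Fin k)) :
    ParamFormula L G (Fin 1) → Prop
  | inst (b : Fin k → G) : IsDeltaFormula δ (δ.inst b)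
  | neg {φ : ParamFormula L G (Fin 1)} : IsDeltaFormula δ φ → IsDeltaFormula δ φ.neg
  | conj {φ ψ : ParamFormula L G (Fin 1)} :
      IsDeltaFormula δ φ → IsDeltaFormula δ ψ → IsDeltaFormula δ (φ.conj ψ)
  | disj {φ ψ : ParamFormula L G (Fin 1)} :
      IsDeltaFormula δ φ → IsDeltaFormula δ ψ → IsDeltaFormula δ (φ.disj ψ)

end ParamFormula

/-! ### Pseudofinite structures and the pseudofinite counting measure -/

/-- The language with, for each `L`-formula `φ(x̄; ȳ)` and each rational `q`, a relation symbol
`[μ_φ ≤ q](ȳ)`. -/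
def countLang (L : FirstOrder.Language.{u, v}) : FirstOrder.Language.{0, max u v} :=
  ⟨fun _ => Empty, fun n => (Σ m : ℕ, L.Formula (Fin m ⊕ Fin n)) × ℚ⟩

/-- The expansion `L⁺` of `L` in which counting measures are visible. -/
abbrev plusLang (L : FirstOrder.Language.{u, v}) : FirstOrder.Language.{u, max u v} :=
  L.sum (countLang L)

/-- In a finite structure `A`, the symbol `[μ_φ ≤ q](ȳ)` says that the normalized counting measure
of `φ(A^x̄; ȳ)` is at most `q`. -/
@[reducible]
def countStructure (L : FirstOrder.Language.{u, v}) (A : Type w) [L.Structure A] :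
    (countLang L).Structure A where
  funMap := fun f => f.elim
  RelMap := fun R b =>
    (Nat.card {a : Fin R.1.1 → A // R.1.2.Realize (Sum.elim a b)} : ℚ) /
      (Nat.card (Fin R.1.1 → A) : ℚ) ≤ R.2

/-- The `L⁺`-structure `G` is (up to isomorphism) an elementary extension of the ultraproduct along
`U` of the canonical `L⁺`-expansions of the `L`-structures `A i`. -/
def IsElementaryExtensionOfUltraproduct (L : FirstOrder.Language.{u, v}) {ι : Type w}
    (U : Ultrafilter ι) (A : ι → Type w') [∀ i, L.Structure (A i)]
    (G : Type w'') [L.Structure G] [(countLang L).Structure G] : Prop :=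
  letI : ∀ i, (countLang L).Structure (A i) := fun i => countStructure L (A i)
  Nonempty (((U : Filter ι).Product A) ↪ₑ[plusLang L] G)

/-- The symbol `mulSym` is interpreted as the group operation. -/
def InterpretsMul {L : FirstOrder.Language.{u, v}} (mulSym : L.Functions 2) (A : Type w) [Group A]
    [L.Structure A] : Prop :=
  ∀ a b : A, funMap mulSym ![a, b] = a * b

/-- The pseudofinite counting measure of `φ(x̄) = θ(x̄; b̄)`: the standard part of `μ_θ(b̄)`, that
is, the infimum of the rationals `q` with `G ⊨ [μ_θ ≤ q](b̄)`. -/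
noncomputable def mu {L : FirstOrder.Language.{u, v}} {G : Type w} [(countLang L).Structure G]
    {m : ℕ} (φ : ParamFormula L G (Fin m)) : ℝ :=
  sInf {r : ℝ | ∃ q : ℚ, r = q ∧
    RelMap (L := countLang L) (M := G) (n := φ.n) (⟨m, φ.form⟩, q) φ.par}

/-! ### Generic sets -/

section Generic

variable {G : Type w} [Group G]

/-- `n` left translates of `A` cover `G`. -/
def IsLeftNGeneric (n : ℕ) (A : Set G) : Prop :=
  ∃ g : Fin n → G, ⋃ i, (fun x => g i * x) '' A = Set.univ

/-- `n` right translates of `A` cover `G`. -/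
def IsRightNGeneric (n : ℕ) (A : Set G) : Prop :=
  ∃ g : Fin n → G, ⋃ i, (fun x => x * g i) '' A = Set.univ

/-- Left generic sets. -/
def IsLeftGeneric (A : Set G) : Prop := ∃ n, 1 ≤ n ∧ IsLeftNGeneric n A

/-- Right generic sets. -/
def IsRightGeneric (A : Set G) : Prop := ∃ n, 1 ≤ n ∧ IsRightNGeneric n A

end Generic

/-! ### Complete `δ`-types over `G`

Formulas in a type are taken up to equivalence in `G`, so a type is a family of subsets of `G`. -/

section Types

variable {L : FirstOrder.Language.{u, v}} {G : Type w} [L.Structure G] {k : ℕ}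

/-- `X` is defined by an instance `δ(x; b̄)` or `¬ δ(x; b̄)`. -/
def IsInstanceSet (δ : ParamFormula L G (Fin 1 ⊕ Fin k)) (X : Set G) : Prop :=
  ∃ b : Fin k → G, X = (δ.inst b).set ∨ X = (δ.inst b).neg.set

/-- Consistency over `G`, i.e. finite satisfiability in `G`. -/
def IsConsistent (p : Set (Set G)) : Prop :=
  ∀ s ⊆ p, s.Finite → (⋂₀ s).Nonempty

/-- The space `S_δ(G)` of complete `δ`-types over `G`: maximal consistent sets of instances. -/
def typeSpace (δ : ParamFormula L G (Fin 1 ⊕ Fin k)) : Set (Set (Set G)) :=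
  {p | Maximal (fun q : Set (Set G) => (∀ X ∈ q, IsInstanceSet δ X) ∧ IsConsistent q) p}

/-- The formula `φ(x)` belongs to the type `p`, i.e. finitely many members of `p` imply it. (For
complete `p` and `φ` an instance, this just says that `φ(G)` is a member of `p`.) -/
def InType (φ : ParamFormula L G (Fin 1)) (p : Set (Set G)) : Prop :=
  ∃ s ⊆ p, s.Finite ∧ ⋂₀ s ⊆ φ.set

variable [Group G]

/-- A `δ`-type is left generic if every `δ`-formula in it is. -/
def IsLeftGenericType (δ : ParamFormula L G (Fin 1 ⊕ Fin k)) (p : Set (Set G)) : Prop :=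
  ∀ φ, δ.IsDeltaFormula φ → InType φ p → IsLeftGeneric φ.set

/-- A `δ`-type is right generic if every `δ`-formula in it is. -/
def IsRightGenericType (δ : ParamFormula L G (Fin 1 ⊕ Fin k)) (p : Set (Set G)) : Prop :=
  ∀ φ, δ.IsDeltaFormula φ → InType φ p → IsRightGeneric φ.set

end Types

section Translates

variable {G : Type w} [Group G]

/-- `gp = {φ(g⁻¹ x) : φ(x) ∈ p}`. -/
def leftTranslate (g : G) (p : Set (Set G)) : Set (Set G) :=
  (fun X => {x | g⁻¹ * x ∈ X}) '' p

/-- `pg = {φ(x g⁻¹) : φ(x) ∈ p}`. -/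
def rightTranslate (p : Set (Set G)) (g : G) : Set (Set G) :=
  (fun X => {x | x * g⁻¹ ∈ X}) '' p

end Translates

end PseudofiniteNIP

open PseudofiniteNIP

/-! The engine is the ε-net theorem of Vapnik–Chervonenkis theory. In a finite group all translates
of a set `X` have the density of `X`. If that density is at least `q > 0` and the family `{x | y * x
∈ X}` is `k`-NIP, then a set of `N = N(k, q)` points meets all these translates, so `N` right
translates of `X` cover. The dual family, which is `2 ^ k`-NIP, yields left translates
(`exists_net_bound`, `exists_rightCover_bound`, `exists_leftCover_bound`). Conversely, a cover by
`N` translates forces density at least `1 / N`.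

Since `N` depends only on `k` and `q`, each of these facts is an `L⁺`-formula valid in every `A i`;
Łoś's theorem and elementarity carry it to `G` (`realize_of_forall_finite`). This gives part 1.

For part 2, invariance absorbs left multiplication into the parameters of `δ`, and the extra
variable `u` of `δʳ` absorbs right multiplication. So `φˡ` is NIP for each instance `φ` of `δʳ`,
hence for Boolean combinations, and part 1 applies. Null sets form an ideal, so some ultrafilter
contains no null `δʳ`-formula; its traces on the instances of `δʳ` and of `δ` are the required
types. -/

namespace PseudofiniteNIP

open FirstOrder.Language FirstOrder.Language.Structure

universe u v w w' w''

/-! ### NIP relations and nets -/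

section Combinatorics

open Finset

/-- No `k` points are shattered by the sets `{x | R x y}`. -/
def RelNIP {α : Type*} {β : Type*} (k : ℕ) (R : α → β → Prop) : Prop :=
  ¬ ∃ (a : Fin k → α) (b : Set (Fin k) → β), ∀ i X, R (a i) (b X) ↔ i ∈ X

variable {α : Type*} {β : Type*}

/-- The dual of a `k`-NIP relation is `2 ^ k`-NIP. -/
theorem RelNIP.swap {k : ℕ} {R : α → β → Prop} (h : RelNIP k R) :
    RelNIP (2 ^ k) (fun y x => R x y) := by
  rintro ⟨a, b, hab⟩
  have hc : Fintype.card (Set (Fin k)) = Fintype.card (Fin (2 ^ k)) := by simp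
  let e : Set (Fin k) ≃ Fin (2 ^ k) := Fintype.equivOfCardEq hc
  -- The shattered points are indexed by the subsets `S` of `Fin k`. The parameter cutting out `{S |
  -- j ∈ S}` becomes the `j`-th point, and the point indexed by `S` becomes a parameter.
  refine h ⟨fun j => b (e '' {S | j ∈ S}), fun S => a (e S), fun j S => ?_⟩
  exact (hab _ _).trans (by simp)

theorem RelNIP.not {k : ℕ} {R : α → β → Prop} (h : RelNIP k R) :
    RelNIP k (fun x y => ¬ R x y) := by
  rintro ⟨a, b, hab⟩
  refine h ⟨a, fun X => b Xᶜ, fun i X => ?_⟩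
  have := hab i Xᶜ
  rw [Set.mem_compl_iff] at this
  tauto

/-- The traces on a finite family of points of the sets `{x | R x y}`. -/
noncomputable def traces (R : α → β → Prop) {I : Type*} [Fintype I] (a : I → α) :
    Finset (Finset I) :=
  open Classical in univ.filter fun T => ∃ b, ∀ i, i ∈ T ↔ R (a i) b

theorem mem_traces {R : α → β → Prop} {I : Type*} [Fintype I] {a : I → α} {T : Finset I} :
    T ∈ traces R a ↔ ∃ b, ∀ i, i ∈ T ↔ R (a i) b := by
  simp [traces]

/-- A NIP relation has polynomially many traces on finite sets, by the Sauer–Shelah lemma. -/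
theorem RelNIP.card_traces_le {k : ℕ} {R : α → β → Prop} (h : RelNIP k R) {I : Type*} [Fintype I]
    (a : I → α) : (traces R a).card ≤ k * (Fintype.card I + 1) ^ k := by
  classical
  -- A set family has at most as many members as it shatters sets, so it suffices that every
  -- shattered index set has fewer than `k` elements.
  have hsub : (traces R a).shatterer ⊆ (range k).biUnion fun j => powersetCard j univ := by
    intro s hs
    rw [mem_shatterer] at hs
    simp only [mem_biUnion, mem_range, mem_powersetCard, subset_univ, true_and, exists_eq_right']
    by_contra hk
    push Not at hk
    obtain ⟨t, hts, htk⟩ := exists_subset_card_eq hk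
    let e : Fin k ≃ t := (t.equivFinOfCardEq htk).symm
    have key : ∀ X : Set (Fin k), ∃ b, ∀ i, R (a (e i)) b ↔ i ∈ X := by
      intro X
      obtain ⟨u, hu, hsu⟩ := hs (t := univ.filter fun x => ∃ i ∈ X, (e i : I) = x) (by
        intro x hx
        obtain ⟨i, -, rfl⟩ := (mem_filter.1 hx).2
        exact hts (e i).2)
      obtain ⟨b, hb⟩ := mem_traces.1 hu
      refine ⟨b, fun i => ?_⟩
      rw [← hb]
      have := congrArg (fun v => (e i : I) ∈ v) hsu
      simp only [mem_inter, mem_filter, mem_univ, true_and, hts (e i).2, eq_iff_iff,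
        SetLike.coe_eq_coe, EmbeddingLike.apply_eq_iff_eq, exists_eq_right] at this
      exact this
    choose b hb using key
    exact h ⟨fun i => a (e i), b, fun i X => hb X i⟩
  calc (traces R a).card ≤ (traces R a).shatterer.card := card_le_card_shatterer _
    _ ≤ _ := card_le_card hsub
    _ ≤ ∑ j ∈ range k, (powersetCard j (univ : Finset I)).card := card_biUnion_le
    _ ≤ ∑ j ∈ range k, (Fintype.card I + 1) ^ k := by
      refine sum_le_sum fun j hj => ?_
      rw [card_powersetCard, card_univ]
      calc _ ≤ Fintype.card I ^ j := Nat.choose_le_pow _ _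
        _ ≤ (Fintype.card I + 1) ^ j := Nat.pow_le_pow_left (Nat.le_succ _) _
        _ ≤ _ := Nat.pow_le_pow_right (Nat.succ_pos _) (mem_range.1 hj).le
    _ = _ := by simp

/-- Supplies the sample size in the net theorem, where the `2m + 1` comes from counting traces on a
double sample of `2m` points. -/
theorem eventually_poly_lt_exp (C : ℝ) (k : ℕ) {c : ℝ} (hc : 0 < c) :
    ∀ᶠ m : ℕ in Filter.atTop, C * (2 * (m : ℝ) + 1) ^ k < (2 : ℝ) ^ (c * m) := by
  have hr : |(2 : ℝ) ^ (-c)| < 1 := by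
    rw [abs_of_pos (by positivity)]
    exact Real.rpow_lt_one_of_one_lt_of_neg (by norm_num) (by linarith)
  have h := (tendsto_pow_const_mul_const_pow_of_abs_lt_one k hr).const_mul (|C| * 3 ^ k)
  rw [mul_zero] at h
  filter_upwards [h.eventually (gt_mem_nhds zero_lt_one), Filter.eventually_ge_atTop 1] with m hm h1
  have h1' : (1 : ℝ) ≤ m := by exact_mod_cast h1
  have hpos : (0 : ℝ) < 2 ^ (c * m) := by positivity
  have hinv : ((2 : ℝ) ^ (-c)) ^ m = ((2 : ℝ) ^ (c * m))⁻¹ := by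
    rw [← Real.rpow_natCast, ← Real.rpow_mul (by norm_num), ← Real.rpow_neg (by norm_num)]
    ring_nf
  rw [hinv, ← mul_assoc, ← div_eq_mul_inv, div_lt_one hpos] at hm
  refine lt_of_le_of_lt ?_ hm
  rw [mul_assoc, ← mul_pow]
  gcongr
  · exact le_abs_self C
  · linarith

/-- NIP relations are closed under conjunction. -/
theorem RelNIP.and {k l : ℕ} {R : α → β → Prop} {S : α → β → Prop} (hR : RelNIP k R)
    (hS : RelNIP l S) : ∃ m, 1 ≤ m ∧ RelNIP m (fun x y => R x y ∧ S x y) := by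
  classical
  obtain ⟨m, hm, h1⟩ := ((eventually_poly_lt_exp (k * l) (k + l) one_pos).and
    (Filter.eventually_ge_atTop 1)).exists
  refine ⟨m, h1, ?_⟩
  rintro ⟨a, b, hab⟩
  -- If `m` points are shattered by the conjunction, each of their `2 ^ m` subsets is a trace of `R`
  -- intersected with a trace of `S`; there are only polynomially many such pairs.
  have hsub : (univ : Finset (Finset (Fin m))) ⊆
      ((traces R a) ×ˢ (traces S a)).image fun p => p.1 ∩ p.2 := by
    intro X _
    refine mem_image.2 ⟨(univ.filter fun i => R (a i) (b X), univ.filter fun i => S (a i) (b X)),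
      mem_product.2 ⟨mem_traces.2 ⟨b X, by simp⟩, mem_traces.2 ⟨b X, by simp⟩⟩, ?_⟩
    ext i
    have := hab i X
    simp only [mem_coe] at this
    simp [this]
  have hcard := (card_le_card hsub).trans (card_image_le.trans_eq (card_product _ _))
  have h2 := hcard.trans (Nat.mul_le_mul (hR.card_traces_le a) (hS.card_traces_le a))
  simp only [card_univ, Fintype.card_finset, Fintype.card_fin] at h2
  have h3 : (2 : ℝ) ^ m ≤ (k * l) * (m + 1) ^ (k + l) := by
    have : ((2 ^ m : ℕ) : ℝ) ≤ ((k * (m + 1) ^ k * (l * (m + 1) ^ l) : ℕ) : ℝ) := by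
      exact_mod_cast h2
    push_cast at this
    rw [pow_add]
    linarith
  rw [one_mul, Real.rpow_natCast] at hm
  refine absurd (h3.trans ?_) (not_le.2 hm)
  gcongr
  linarith [(Nat.cast_nonneg m : (0 : ℝ) ≤ m)]

/-! ### Symmetrization and the ε-net theorem. -/

/-- At most `2 ^ (m - t)` sign vectors avoid `T` while their negatives meet it `t` times. -/
theorem card_sign_vectors_le {m t : ℕ} (T : Finset (Fin m × Bool)) :
    (univ.filter fun σ : Fin m → Bool =>
      (∀ i, (i, σ i) ∉ T) ∧ t ≤ (univ.filter fun i => (i, !σ i) ∈ T).card).card * 2 ^ t ≤ 2 ^ m := by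
  classical
  set P := univ.filter fun σ : Fin m → Bool =>
      (∀ i, (i, σ i) ∉ T) ∧ t ≤ (univ.filter fun i => (i, !σ i) ∈ T).card with hP
  rcases P.eq_empty_or_nonempty with h | ⟨σ₀, hσ₀⟩
  · simp [h]
  set J := univ.filter fun i => (i, !σ₀ i) ∈ T with hJ
  have h₀ := (mem_filter.1 hσ₀).2
  -- For `i ∈ J` the value opposite to `σ₀ i` lands in `T`, which every `σ ∈ P` avoids. So all
  -- members of `P` agree with `σ₀` on `J`, and `J` has at least `t` elements.
  have hsub : P ⊆ Fintype.piFinset fun i => if i ∈ J then {σ₀ i} else univ := by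
    intro σ hσ
    have hσ' := (mem_filter.1 hσ).2
    rw [Fintype.mem_piFinset]
    intro i
    split_ifs with hi
    · rw [mem_singleton]
      by_contra hne
      have : (!σ₀ i) = σ i := by
        revert hne; cases σ i <;> cases σ₀ i <;> simp
      rw [hJ, mem_filter, this] at hi
      exact hσ'.1 i hi.2
    · simp
  have hprod : (Fintype.piFinset fun i => if i ∈ J then {σ₀ i} else univ).card * 2 ^ J.card
      = 2 ^ m := by
    rw [Fintype.card_piFinset]
    have h1 : ∀ i, (if i ∈ J then {σ₀ i} else (univ : Finset Bool)).card
        = if i ∈ J then 1 else 2 := by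
      intro i; split_ifs <;> simp
    have h2 : 2 ^ J.card = ∏ i : Fin m, if i ∈ J then 2 else 1 := by
      rw [prod_ite_mem, univ_inter, prod_const]
    rw [h2, ← prod_mul_distrib]
    have h3 : ∀ i, (if i ∈ J then {σ₀ i} else (univ : Finset Bool)).card *
        (if i ∈ J then 2 else 1) = 2 := by
      intro i; split_ifs <;> simp
    rw [prod_congr rfl fun i _ => h3 i]
    simp
  calc P.card * 2 ^ t ≤ _ * 2 ^ J.card :=
        Nat.mul_le_mul (card_le_card hsub) (Nat.pow_le_pow_right (by norm_num) h₀.2)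
    _ = 2 ^ m := hprod

/-- The pairs of `m`-samples such that some set `{x | R x b}` misses the first sample but meets the
second one at least `t` times. -/
noncomputable def badSamples [Fintype α] (R : α → β → Prop) (m t : ℕ) :
    Finset (Fin m → Bool → α) :=
  open Classical in univ.filter fun z =>
    ∃ b, (∀ i, ¬ R (z i false) b) ∧ t ≤ (univ.filter fun i => R (z i true) b).card

/-- Upper bound for the number of bad samples, by symmetrization. -/
theorem RelNIP.card_badSamples_le [Fintype α] {k : ℕ} {R : α → β → Prop} (h : RelNIP k R)
    (m t : ℕ) : (badSamples R m t).card * 2 ^ t ≤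
      (Fintype.card α ^ m * Fintype.card α ^ m) * (k * (2 * m + 1) ^ k) := by
  classical
  set B := badSamples R m t with hB
  -- A sign vector swaps the two entries of selected pairs. This permutes the double samples, so the
  -- bad ones may be counted by fixing `z` and varying `σ`.
  let act : (Fin m → Bool) → (Fin m → Bool → α) → (Fin m → Bool → α) :=
    fun σ z i c => z i (xor c (σ i))
  have hact : ∀ σ z, act σ (act σ z) = z := by
    intro σ z; funext i c; simp [act]
  have hinv : ∀ σ, (univ.filter fun z => act σ z ∈ B).card = B.card := by
    intro σ
    refine card_nbij' (act σ) (act σ) ?_ ?_ ?_ ?_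
    · intro z hz; simpa using hz
    · intro z hz; simpa [hact] using hz
    · intro z _; exact hact σ z
    · intro z _; exact hact σ z
  have hfix : ∀ z : Fin m → Bool → α,
      (univ.filter fun σ => act σ z ∈ B).card * 2 ^ t ≤ k * (2 * m + 1) ^ k * 2 ^ m := by
    intro z
    let a : Fin m × Bool → α := fun p => z p.1 p.2
    -- For fixed `z`, badness of `act σ z` depends only on the trace of a set `{x | R x b}` on the
    -- `2m` points of `z`. This allows a union bound over polynomially many traces.
    have hsub : (univ.filter fun σ => act σ z ∈ B) ⊆ (traces R a).biUnion fun T =>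
        univ.filter fun σ : Fin m → Bool =>
          (∀ i, (i, σ i) ∉ T) ∧ t ≤ (univ.filter fun i => (i, !σ i) ∈ T).card := by
      intro σ hσ
      obtain ⟨b, hb1, hb2⟩ := (mem_filter.1 (mem_filter.1 hσ).2).2
      refine mem_biUnion.2 ⟨univ.filter fun p => R (a p) b, mem_traces.2 ⟨b, by simp⟩, ?_⟩
      simpa [act, a] using And.intro hb1 hb2
    calc _ ≤ (∑ T ∈ traces R a, (univ.filter fun σ : Fin m → Bool =>
          (∀ i, (i, σ i) ∉ T) ∧ t ≤ (univ.filter fun i => (i, !σ i) ∈ T).card).card) * 2 ^ t :=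
          Nat.mul_le_mul_right _ ((card_le_card hsub).trans card_biUnion_le)
      _ ≤ ∑ T ∈ traces R a, 2 ^ m := by
          rw [sum_mul]
          exact sum_le_sum fun T _ => card_sign_vectors_le T
      _ ≤ _ := by
          rw [sum_const, smul_eq_mul]
          refine Nat.mul_le_mul_right _ ((h.card_traces_le a).trans_eq ?_)
          simp [mul_comm]
  have hdouble : 2 ^ m * B.card = ∑ z : Fin m → Bool → α,
      (univ.filter fun σ => act σ z ∈ B).card := by
    calc 2 ^ m * B.card = ∑ σ : Fin m → Bool, (univ.filter fun z => act σ z ∈ B).card := by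
          simp [hinv]
      _ = _ := by
          simp only [card_filter]
          exact sum_comm
  have hmain : 2 ^ m * (B.card * 2 ^ t) ≤
      2 ^ m * ((Fintype.card α ^ m * Fintype.card α ^ m) * (k * (2 * m + 1) ^ k)) := by
    calc 2 ^ m * (B.card * 2 ^ t) = (2 ^ m * B.card) * 2 ^ t := by ring
      _ ≤ ∑ z : Fin m → Bool → α, k * (2 * m + 1) ^ k * 2 ^ m := by
          rw [hdouble, sum_mul]
          exact sum_le_sum fun z _ => hfix z
      _ = _ := by
          simp only [sum_const, card_univ, Fintype.card_fun, Fintype.card_bool, Fintype.card_fin,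
            smul_eq_mul]
          ring
  exact Nat.le_of_mul_le_mul_left hmain (by positivity)

/-- One coordinate is restricted to `S`, the others are free; the factor `Fintype.card α` on the
left avoids the exponent `m - 1`. -/
theorem card_coordinate_mem [Fintype α] {m : ℕ} (S : Finset α) (i : Fin m) :
    (open Classical in univ.filter fun y : Fin m → α => y i ∈ S).card * Fintype.card α =
      S.card * Fintype.card α ^ m := by
  classical
  have h : (univ.filter fun y : Fin m → α => y i ∈ S) =
      Fintype.piFinset (Function.update (fun _ => univ) i S) := by
    ext y
    simp only [mem_filter, mem_univ, true_and, Fintype.mem_piFinset]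
    constructor
    · intro hy j
      rcases eq_or_ne j i with rfl | hj
      · simpa using hy
      · simp [hj]
    · intro hy
      simpa using hy i
  rw [h, Fintype.card_piFinset]
  have h1 : ∀ j, (Function.update (fun _ => (univ : Finset α)) i S j).card =
      Function.update (fun _ => Fintype.card α) i S.card j := by
    intro j
    rcases eq_or_ne j i with rfl | hj <;> simp [*]
  rw [prod_congr rfl fun j _ => h1 j, prod_update_of_mem (mem_univ i), mul_assoc]
  congr 1
  rw [prod_const, ← pow_succ, card_sdiff_of_subset (by simp)]
  have : 0 < m := i.pos
  simp [Nat.sub_add_cancel this]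

/-- A set of density at least `ε` meets a positive proportion of the `m`-samples often. -/
theorem card_frequent_samples_ge [Fintype α] [Nonempty α] {ε : ℝ} {S : Finset α}
    (hS : ε * Fintype.card α ≤ S.card) {m : ℕ} (hm : 0 < m) :
    ε / 2 * (Fintype.card α : ℝ) ^ m ≤ ((open Classical in univ.filter fun y : Fin m → α =>
      ⌈ε / 2 * m⌉₊ ≤ (univ.filter fun i => y i ∈ S).card).card : ℝ) := by
  classical
  set n : ℝ := (Fintype.card α : ℝ) with hn
  have hnpos : 0 < n := by rw [hn]; exact_mod_cast Fintype.card_pos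
  have hmpos : (0 : ℝ) < m := by exact_mod_cast hm
  set Q := univ.filter fun y : Fin m → α =>
      ⌈ε / 2 * m⌉₊ ≤ (univ.filter fun i => y i ∈ S).card with hQ
  have hcoord : ∀ i : Fin m,
      ((univ.filter fun y : Fin m → α => y i ∈ S).card : ℝ) * n = S.card * n ^ m := by
    intro i
    have := card_coordinate_mem S i
    rw [hn]
    exact_mod_cast this
  have hsum : ∑ y : Fin m → α, ((univ.filter fun i => y i ∈ S).card : ℝ) =
      ∑ i : Fin m, ((univ.filter fun y : Fin m → α => y i ∈ S).card : ℝ) := by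
    simp only [card_filter, Nat.cast_sum]
    exact sum_comm
  have hlow : ε * m * n ^ m ≤ ∑ y : Fin m → α, ((univ.filter fun i => y i ∈ S).card : ℝ) := by
    rw [hsum]
    have : ∀ i : Fin m, ε * n ^ m ≤ ((univ.filter fun y : Fin m → α => y i ∈ S).card : ℝ) := by
      intro i
      refine le_of_mul_le_mul_right ?_ hnpos
      rw [hcoord i]
      have := mul_le_mul_of_nonneg_right hS (pow_nonneg hnpos.le m)
      linarith
    have h2 := card_nsmul_le_sum univ _ _ fun i _ => this i
    simp only [card_univ, Fintype.card_fin, nsmul_eq_mul] at h2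
    linarith
  -- Reverse Markov inequality: the mean number of hits is at least `ε * m`, while samples outside
  -- `Q` have fewer than `ε / 2 * m` and all others at most `m`. The absolute value covers the case
  -- `ε < 0`, not yet excluded.
  have hup : ∀ y : Fin m → α, ((univ.filter fun i => y i ∈ S).card : ℝ) ≤
      (if y ∈ Q then (m : ℝ) else 0) + |ε / 2 * m| := by
    intro y
    split_ifs with hy
    · have : (univ.filter fun i => y i ∈ S).card ≤ m := by
        simpa using card_le_univ (univ.filter fun i => y i ∈ S)
      have : ((univ.filter fun i => y i ∈ S).card : ℝ) ≤ m := by exact_mod_cast this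
      linarith [abs_nonneg (ε / 2 * m)]
    · have : (univ.filter fun i => y i ∈ S).card < ⌈ε / 2 * m⌉₊ := by
        simpa only [hQ, mem_filter, mem_univ, true_and, not_le] using hy
      linarith [Nat.lt_ceil.1 this, le_abs_self (ε / 2 * m)]
  rcases le_total ε 0 with hε | hε
  · have h0 : (0 : ℝ) ≤ Q.card := Nat.cast_nonneg _
    have : ε / 2 * n ^ m ≤ 0 := mul_nonpos_of_nonpos_of_nonneg (by linarith) (by positivity)
    linarith
  have htot := hlow.trans (sum_le_sum fun y _ => hup y)
  rw [sum_add_distrib, sum_ite_mem, univ_inter, sum_const, sum_const, card_univ, Fintype.card_fun,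
    Fintype.card_fin, abs_of_nonneg (by positivity), nsmul_eq_mul, nsmul_eq_mul, Nat.cast_pow,
    ← hn] at htot
  refine le_of_mul_le_mul_right ?_ hmpos
  linarith

/-- Sets of density at least `ε` in a `k`-NIP family on a finite set have a common net, whose size
depends on `k` and `ε` only. -/
theorem exists_net_bound (k : ℕ) {ε : ℝ} (hε : 0 < ε) :
    ∃ m, 1 ≤ m ∧ ∀ (α : Type w) (β : Type w') [Fintype α] [Nonempty α] (R : α → β → Prop),
      RelNIP k R →
      (∀ b, ε * Fintype.card α ≤ ((open Classical in univ.filter fun a => R a b).card : ℝ)) →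
      ∃ x : Fin m → α, ∀ b, ∃ i, R (x i) b := by
  classical
  -- This `m` makes `2 ^ (ε / 2 * m)` exceed `(2 / ε) * k * (2 * m + 1) ^ k`, contradicting the two
  -- counts of bad samples below.
  obtain ⟨m, hm, h1⟩ := ((eventually_poly_lt_exp (2 / ε * k) k (half_pos hε)).and
    (Filter.eventually_ge_atTop 1)).exists
  refine ⟨m, h1, ?_⟩
  intro α β _ _ R hR hdens
  by_contra! hnet
  choose b hb using hnet
  set t := ⌈ε / 2 * m⌉₊ with ht
  set n : ℝ := (Fintype.card α : ℝ) with hn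
  have hnpos : 0 < n := by rw [hn]; exact_mod_cast Fintype.card_pos
  -- Every first sample `x` is missed by the dense set with parameter `b x`, and a proportion of at
  -- least `ε / 2` of the second samples meets that set often.
  have hlow : ε / 2 * n ^ m * n ^ m ≤ ((badSamples R m t).card : ℝ) := by
    have hinj : (univ.filter fun p : (Fin m → α) × (Fin m → α) =>
        t ≤ (univ.filter fun i => R (p.2 i) (b p.1)).card).card ≤ (badSamples R m t).card := by
      refine card_le_card_of_injOn (fun p i c => if c then p.2 i else p.1 i) ?_ ?_
      · intro p hp
        have hp' := (mem_filter.1 (mem_coe.1 hp)).2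
        simp only [badSamples, coe_filter, Set.mem_ofPred_eq, mem_univ, true_and]
        exact ⟨b p.1, by simpa using hb p.1, by simpa using hp'⟩
      · intro p _ q _ hpq
        refine Prod.ext ?_ ?_ <;> funext i
        · simpa using congrFun (congrFun hpq i) false
        · simpa using congrFun (congrFun hpq i) true
    have hcount : (univ.filter fun p : (Fin m → α) × (Fin m → α) =>
        t ≤ (univ.filter fun i => R (p.2 i) (b p.1)).card).card =
        ∑ x : Fin m → α, (univ.filter fun y : Fin m → α =>
          t ≤ (univ.filter fun i => R (y i) (b x)).card).card := by
      simp only [card_filter, Fintype.sum_prod_type]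
    have hx : ∀ x : Fin m → α, ε / 2 * n ^ m ≤ ((univ.filter fun y : Fin m → α =>
          t ≤ (univ.filter fun i => R (y i) (b x)).card).card : ℝ) := by
      intro x
      have := card_frequent_samples_ge (S := univ.filter fun a => R a (b x)) (hdens (b x)) h1
      simpa only [mem_filter, mem_univ, true_and] using this
    have h2 := card_nsmul_le_sum univ _ _ fun x _ => hx x
    simp only [card_univ, Fintype.card_fun, Fintype.card_fin, nsmul_eq_mul, Nat.cast_pow] at h2
    have h3 := (Nat.cast_le (α := ℝ)).2 (hcount ▸ hinj)
    push_cast at h3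
    linarith
  have hup : ((badSamples R m t).card : ℝ) * 2 ^ t ≤ n ^ m * n ^ m * (k * (2 * m + 1) ^ k) := by
    have := hR.card_badSamples_le m t
    rw [hn]
    exact_mod_cast this
  have hexp : (2 : ℝ) ^ (ε / 2 * m) ≤ 2 ^ t := by
    rw [← Real.rpow_natCast]
    exact Real.rpow_le_rpow_of_exponent_le (by norm_num) (Nat.le_ceil _)
  have hN : 0 < n ^ m * n ^ m := by positivity
  have h4 : ε / 2 * 2 ^ t ≤ k * (2 * m + 1) ^ k := by
    refine le_of_mul_le_mul_left ?_ hN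
    have := mul_le_mul_of_nonneg_right hlow (by positivity : (0 : ℝ) ≤ 2 ^ t)
    linarith
  have h5 : (2 : ℝ) ^ t ≤ 2 / ε * k * (2 * m + 1) ^ k := by
    have := mul_le_mul_of_nonneg_left h4 (by positivity : (0 : ℝ) ≤ 2 / ε)
    have e : 2 / ε * (ε / 2 * 2 ^ t) = (2 : ℝ) ^ t := by field_simp
    linarith
  linarith

end Combinatorics

/-! ### Uniform genericity in finite groups -/

section FiniteGroups

theorem RelNIP.comap {α β α' β' : Type*} {k : ℕ} {R : α → β → Prop} (h : RelNIP k R)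
    {R' : α' → β' → Prop} (f : α' → α) (g : β' → β) (hR : ∀ x y, R' x y ↔ R (f x) (g y)) :
    RelNIP k R' := by
  rintro ⟨a, b, hab⟩
  exact h ⟨fun i => f (a i), fun X => g (b X), fun i X => (hR _ _).symm.trans (hab i X)⟩

/-- The sets `{x | y * x ∈ X}` are left translates of `X`, all of the same size. A net `g` for them
gives `y * g i ∈ X` for some `i`, whatever `y`. -/
theorem exists_rightCover_bound (k : ℕ) {q : ℚ} (hq : 0 < q) :
    ∃ N, 1 ≤ N ∧ ∀ (A : Type w) [Group A] [Finite A] (X : Set A),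
      RelNIP k (fun x y : A => y * x ∈ X) → q * Nat.card A ≤ Nat.card X →
      ∃ g : Fin N → A, ∀ x, ∃ i, x * g i ∈ X := by
  classical
  obtain ⟨N, hN, h⟩ := exists_net_bound.{w, w} k (ε := (q : ℝ)) (by exact_mod_cast hq)
  refine ⟨N, hN, fun A _ _ X hX hcard => ?_⟩
  have := Fintype.ofFinite A
  refine h A A _ hX fun y => ?_
  have e : (Finset.univ.filter fun x => y * x ∈ X).card = Nat.card X := by
    rw [← Fintype.card_subtype, ← Nat.card_eq_fintype_card]
    exact Nat.card_congr ((Equiv.mulLeft y).subtypeEquiv fun x => Iff.rfl)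
  rw [e, ← Nat.card_eq_fintype_card]
  exact_mod_cast hcard

/-- Same argument for the dual relation, whose sets are right translates of `X`. -/
theorem exists_leftCover_bound (k : ℕ) {q : ℚ} (hq : 0 < q) :
    ∃ N, 1 ≤ N ∧ ∀ (A : Type w) [Group A] [Finite A] (X : Set A),
      RelNIP k (fun x y : A => y * x ∈ X) → q * Nat.card A ≤ Nat.card X →
      ∃ g : Fin N → A, ∀ x, ∃ i, g i * x ∈ X := by
  classical
  obtain ⟨N, hN, h⟩ := exists_net_bound.{w, w} (2 ^ k) (ε := (q : ℝ)) (by exact_mod_cast hq)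
  refine ⟨N, hN, fun A _ _ X hX hcard => ?_⟩
  have := Fintype.ofFinite A
  refine h A A _ hX.swap fun y => ?_
  have e : (Finset.univ.filter fun x => x * y ∈ X).card = Nat.card X := by
    rw [← Fintype.card_subtype, ← Nat.card_eq_fintype_card]
    exact Nat.card_congr ((Equiv.mulRight y).subtypeEquiv fun x => Iff.rfl)
  rw [e, ← Nat.card_eq_fintype_card]
  exact_mod_cast hcard

/-- If `N` preimages of `X` under permutations cover, then `X` has density at least `1 / N`. -/
theorem card_le_mul_of_cover {A : Type*} [Finite A] {N : ℕ} (X : Set A) (e : Fin N → A ≃ A)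
    (h : ∀ x, ∃ i, e i x ∈ X) : Nat.card A ≤ N * Nat.card X := by
  choose i hi using h
  have hinj : Function.Injective (fun x : A => (i x, (⟨e (i x) x, hi x⟩ : X))) := by
    intro x y hxy
    simp only [Prod.mk.injEq, Subtype.mk.injEq] at hxy
    obtain ⟨h1, h2⟩ := hxy
    rw [h1] at h2
    exact (e (i y)).injective h2
  simpa [Nat.card_prod] using Nat.card_le_card_of_injective _ hinj

end FiniteGroups

/-! ### Transfer from finite structures -/

section Transfer

variable {L : FirstOrder.Language.{u, v}}

/-- An `L`-formula as an `L⁺`-formula. -/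
def liftFormula {γ : Type*} (χ : L.Formula γ) : (plusLang L).Formula γ :=
  (LHom.sumInl : L →ᴸ plusLang L).onFormula χ

/-- The atomic `L⁺`-formula `[μ_θ ≤ q](z̄)`. -/
def countAtom {γ : Type*} {m n : ℕ} (θ : L.Formula (Fin m ⊕ Fin n)) (q : ℚ) (s : Fin n → γ) :
    (plusLang L).Formula γ :=
  Relations.formula (L := plusLang L) (n := n) (Sum.inr (⟨m, θ⟩, q)) fun j => Term.var (s j)

theorem realize_liftFormula {M : Type*} [L.Structure M] [(countLang L).Structure M] {γ : Type*}
    (χ : L.Formula γ) (z : γ → M) : (liftFormula χ).Realize z ↔ χ.Realize z :=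
  LHom.realize_onFormula _ _

theorem realize_countAtom {M : Type*} [L.Structure M] [(countLang L).Structure M] {γ : Type*}
    {m n : ℕ} (θ : L.Formula (Fin m ⊕ Fin n)) (q : ℚ) (s : Fin n → γ) (z : γ → M) :
    (countAtom θ q s).Realize z ↔
      RelMap (L := countLang L) (M := M) (n := n) (⟨m, θ⟩, q) (z ∘ s) :=
  Formula.realize_rel

/-- The definable set `θ(M; z̄)`. -/
def fiber {M : Type*} [L.Structure M] {n : ℕ} (θ : L.Formula (Fin 1 ⊕ Fin n)) (z : Fin n → M) :
    Set M :=
  {x | θ.Realize (Sum.elim (fun _ => x) z)}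

theorem relMap_countStructure {A : Type w} [L.Structure A] {n : ℕ}
    (θ : L.Formula (Fin 1 ⊕ Fin n)) (q : ℚ) (z : Fin n → A) :
    (countStructure L A).RelMap (n := n) (⟨1, θ⟩, q) z ↔
      (Nat.card (fiber θ z) : ℚ) / Nat.card A ≤ q := by
  have h1 : Nat.card {a : Fin 1 → A // θ.Realize (Sum.elim a z)} = Nat.card (fiber θ z) := by
    refine Nat.card_congr ((Equiv.funUnique (Fin 1) A).subtypeEquiv fun a => ?_)
    have : a = fun _ => a 0 := by
      funext i; rw [Subsingleton.elim i 0]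
    change _ ↔ θ.Realize (Sum.elim (fun _ => a 0) z)
    rw [← this]
  have h2 : Nat.card (Fin 1 → A) = Nat.card A := Nat.card_congr (Equiv.funUnique (Fin 1) A)
  change (Nat.card {a : Fin 1 → A // θ.Realize (Sum.elim a z)} : ℚ) / (Nat.card (Fin 1 → A) : ℚ) ≤ q
    ↔ _
  rw [h1, h2]

/-- Ultraproducts commute with sums of languages. -/
theorem sumStructure_ultraproduct {L' : FirstOrder.Language} {ι : Type w} (U : Ultrafilter ι)
    (A : ι → Type w') [∀ i, L.Structure (A i)] [∀ i, L'.Structure (A i)] :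
    sumStructure L L' ((U : Filter ι).Product A) =
      Ultraproduct.structure (L := L.sum L') (M := A) (u := U) := by
  ext n f x
  · cases f <;> rfl
  · cases f <;> rfl

/-- An `L⁺`-formula that is valid in the finite structures `A i` is valid in `G`. -/
theorem realize_of_forall_finite {ι : Type w} {U : Ultrafilter ι} {A : ι → Type w'}
    [∀ i, L.Structure (A i)] [∀ i, Nonempty (A i)] {G : Type w''} [L.Structure G]
    [(countLang L).Structure G] (hext : IsElementaryExtensionOfUltraproduct L U A G)
    {γ : Type*} [Finite γ] (ψ : (plusLang L).Formula γ)
    (h : letI : ∀ i, (countLang L).Structure (A i) := fun i => countStructure L (A i)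
      ∀ i (z : γ → A i), ψ.Realize z) (z : γ → G) : ψ.Realize z := by
  let : ∀ i, (countLang L).Structure (A i) := fun i => countStructure L (A i)
  obtain ⟨f⟩ := hext
  -- Universal closure gives a sentence, so parameters of `G` outside the image of the ultraproduct
  -- are covered too.
  let σ : (plusLang L).Sentence := Formula.iAlls γ (ψ.relabel (Sum.inr : γ → Empty ⊕ γ))
  have hσG : G ⊨ σ ↔ ∀ z : γ → G, ψ.Realize z := by
    simp only [σ, Sentence.Realize, Formula.realize_iAlls, Formula.realize_relabel]
    rfl
  refine hσG.1 ((f.map_sentence σ).1 ?_) z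
  have key := (Ultraproduct.sentence_realize (u := U) (M := A) (L := plusLang L) σ).2
    (Filter.Eventually.of_forall fun i => by
      simp only [σ, Sentence.Realize, Formula.realize_iAlls, Formula.realize_relabel]
      exact fun z => h i z)
  -- The embedding uses the sum of two ultraproduct structures, Łoś's theorem the ultraproduct of
  -- the sums.
  convert key using 1
  exact sumStructure_ultraproduct U A

end Transfer

/-! ### First-order expressions for covering and shattering -/

section Expressions

variable {L : FirstOrder.Language.{u, v}} (mulSym : L.Functions 2)

/-- The formula `θ(a · b; s̄)` in variables `a`, `b`, `s̄` from `γ`. -/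
def mulSubst {γ : Type} {n : ℕ} (θ : L.Formula (Fin 1 ⊕ Fin n)) (a b : γ) (s : Fin n → γ) :
    L.Formula γ :=
  θ.subst (Sum.elim (fun _ => mulSym.apply₂ (Term.var a) (Term.var b)) fun j => Term.var (s j))

/-- `N` right translates of `θ(x; z̄)` cover. -/
noncomputable def rightCover {n : ℕ} (N : ℕ) (θ : L.Formula (Fin 1 ⊕ Fin n)) : L.Formula (Fin n) :=
  Formula.iExs (Fin N) (Formula.iAlls (Fin 1) (Formula.iSup fun i : Fin N =>
    mulSubst mulSym θ (Sum.inr 0) (Sum.inl (Sum.inr i)) fun j => Sum.inl (Sum.inl j)))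

/-- `N` left translates of `θ(x; z̄)` cover. -/
noncomputable def leftCover {n : ℕ} (N : ℕ) (θ : L.Formula (Fin 1 ⊕ Fin n)) : L.Formula (Fin n) :=
  Formula.iExs (Fin N) (Formula.iAlls (Fin 1) (Formula.iSup fun i : Fin N =>
    mulSubst mulSym θ (Sum.inl (Sum.inr i)) (Sum.inr 0) fun j => Sum.inl (Sum.inl j)))

open Classical in
/-- Some `k` points are shattered by the formulas `θ(y · x; z̄)`. -/
noncomputable def shatterFormula {n : ℕ} (k : ℕ) (θ : L.Formula (Fin 1 ⊕ Fin n)) :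
    L.Formula (Fin n) :=
  Formula.iExs (Fin k ⊕ Set (Fin k)) (Formula.iInf fun p : Fin k × Set (Fin k) =>
    if p.1 ∈ p.2 then mulSubst mulSym θ (Sum.inr (Sum.inr p.2)) (Sum.inr (Sum.inl p.1)) Sum.inl
    else (mulSubst mulSym θ (Sum.inr (Sum.inr p.2)) (Sum.inr (Sum.inl p.1)) Sum.inl).not)

variable {mulSym} {M : Type*} [Group M] [L.Structure M]

theorem realize_mulSubst (hM : InterpretsMul mulSym M) {γ : Type} {n : ℕ}
    (θ : L.Formula (Fin 1 ⊕ Fin n)) (a b : γ) (s : Fin n → γ) (z : γ → M) :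
    (mulSubst mulSym θ a b s).Realize z ↔ z a * z b ∈ fiber θ (z ∘ s) := by
  rw [mulSubst, Formula.Realize, BoundedFormula.realize_subst]
  change _ ↔ θ.Realize _
  rw [Formula.Realize]
  refine iff_of_eq (congrArg (fun t => BoundedFormula.Realize θ t default) ?_)
  funext c
  cases c with
  | inl c => simpa [Term.realize_functions_apply₂] using hM _ _
  | inr c => simp

theorem realize_rightCover (hM : InterpretsMul mulSym M) {n : ℕ} (N : ℕ)
    (θ : L.Formula (Fin 1 ⊕ Fin n)) (z : Fin n → M) :
    (rightCover mulSym N θ).Realize z ↔ ∃ g : Fin N → M, ∀ x, ∃ i, x * g i ∈ fiber θ z := by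
  simp only [rightCover, Formula.realize_iExs, Formula.realize_iAlls, Formula.realize_iSup,
    realize_mulSubst hM]
  exact exists_congr fun g => ⟨fun h x => h fun _ => x, fun h x => h (x 0)⟩

theorem realize_leftCover (hM : InterpretsMul mulSym M) {n : ℕ} (N : ℕ)
    (θ : L.Formula (Fin 1 ⊕ Fin n)) (z : Fin n → M) :
    (leftCover mulSym N θ).Realize z ↔ ∃ g : Fin N → M, ∀ x, ∃ i, g i * x ∈ fiber θ z := by
  simp only [leftCover, Formula.realize_iExs, Formula.realize_iAlls, Formula.realize_iSup,
    realize_mulSubst hM]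
  exact exists_congr fun g => ⟨fun h x => h fun _ => x, fun h x => h (x 0)⟩

theorem realize_shatterFormula (hM : InterpretsMul mulSym M) {n : ℕ} (k : ℕ)
    (θ : L.Formula (Fin 1 ⊕ Fin n)) (z : Fin n → M) :
    (shatterFormula mulSym k θ).Realize z ↔ ¬ RelNIP k fun x y : M => y * x ∈ fiber θ z := by
  classical
  rw [RelNIP, not_not]
  simp only [shatterFormula, Formula.realize_iExs, Formula.realize_iInf]
  have key : ∀ (c : Fin k ⊕ Set (Fin k) → M) (p : Fin k × Set (Fin k)),
      (if p.1 ∈ p.2 then mulSubst mulSym θ (Sum.inr (Sum.inr p.2)) (Sum.inr (Sum.inl p.1)) Sum.inl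
        else (mulSubst mulSym θ (Sum.inr (Sum.inr p.2)) (Sum.inr (Sum.inl p.1))
          Sum.inl).not).Realize (Sum.elim z c) ↔
      (c (Sum.inr p.2) * c (Sum.inl p.1) ∈ fiber θ z ↔ p.1 ∈ p.2) := by
    intro c p
    split_ifs with h
    · rw [realize_mulSubst hM]
      simp [h]
    · rw [Formula.realize_not, realize_mulSubst hM]
      simp [h]
  constructor
  · rintro ⟨c, hc⟩
    exact ⟨fun i => c (Sum.inl i), fun X => c (Sum.inr X), fun i X => (key c (i, X)).1 (hc (i, X))⟩
  · rintro ⟨a, b, hab⟩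
    exact ⟨Sum.elim a b, fun p => (key _ p).2 (hab p.1 p.2)⟩

end Expressions

/-! ### Genericity and measure -/

section Generic

variable {G : Type*} [Group G]

/-- Inverting the translating elements gives the form that nets produce and `rightCover` expresses.
-/
theorem isRightGeneric_iff {X : Set G} :
    IsRightGeneric X ↔ ∃ N, 1 ≤ N ∧ ∃ g : Fin N → G, ∀ x, ∃ i, x * g i ∈ X := by
  refine exists_congr fun N => and_congr_right fun _ => ?_
  constructor
  · rintro ⟨g, hg⟩
    refine ⟨fun i => (g i)⁻¹, fun x => ?_⟩
    obtain ⟨i, y, hy, rfl⟩ := Set.mem_iUnion.1 (hg ▸ Set.mem_univ x)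
    exact ⟨i, by simpa using hy⟩
  · rintro ⟨g, hg⟩
    refine ⟨fun i => (g i)⁻¹, Set.eq_univ_of_forall fun x => ?_⟩
    obtain ⟨i, hi⟩ := hg x
    exact Set.mem_iUnion.2 ⟨i, _, hi, by simp⟩

theorem isLeftGeneric_iff {X : Set G} :
    IsLeftGeneric X ↔ ∃ N, 1 ≤ N ∧ ∃ g : Fin N → G, ∀ x, ∃ i, g i * x ∈ X := by
  refine exists_congr fun N => and_congr_right fun _ => ?_
  constructor
  · rintro ⟨g, hg⟩
    refine ⟨fun i => (g i)⁻¹, fun x => ?_⟩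
    obtain ⟨i, y, hy, rfl⟩ := Set.mem_iUnion.1 (hg ▸ Set.mem_univ x)
    exact ⟨i, by simpa using hy⟩
  · rintro ⟨g, hg⟩
    refine ⟨fun i => (g i)⁻¹, Set.eq_univ_of_forall fun x => ?_⟩
    obtain ⟨i, hi⟩ := hg x
    exact Set.mem_iUnion.2 ⟨i, _, hi, by simp⟩

theorem IsLeftGeneric.of_left_translate {X : Set G} (g : G)
    (h : IsLeftGeneric {x | g * x ∈ X}) : IsLeftGeneric X := by
  rw [isLeftGeneric_iff] at h ⊢
  obtain ⟨N, hN, f, hf⟩ := h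
  refine ⟨N, hN, fun i => g * f i, fun x => ?_⟩
  obtain ⟨i, hi⟩ := hf x
  exact ⟨i, by rw [mul_assoc]; exact hi⟩

theorem IsLeftGeneric.of_right_translate {X : Set G} (g : G)
    (h : IsLeftGeneric {x | x * g ∈ X}) : IsLeftGeneric X := by
  rw [isLeftGeneric_iff] at h ⊢
  obtain ⟨N, hN, f, hf⟩ := h
  refine ⟨N, hN, f, fun x => ?_⟩
  obtain ⟨i, hi⟩ := hf (x * g⁻¹)
  refine ⟨i, ?_⟩
  have hi' : f i * (x * g⁻¹) * g ∈ X := hi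
  simpa [mul_assoc] using hi'

end Generic

/-- The formula `∀ x, θ₁(x) → θ₂(x) ∨ θ₃(x)`. -/
noncomputable def inclusionFormula {L : FirstOrder.Language.{u, v}} {n₁ n₂ n₃ : ℕ}
    (θ₁ : L.Formula (Fin 1 ⊕ Fin n₁)) (θ₂ : L.Formula (Fin 1 ⊕ Fin n₂))
    (θ₃ : L.Formula (Fin 1 ⊕ Fin n₃)) : L.Formula (Fin n₁ ⊕ (Fin n₂ ⊕ Fin n₃)) :=
  Formula.iAlls (Fin 1) ((θ₁.relabel (Sum.elim Sum.inr fun j => Sum.inl (Sum.inl j))).imp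
    (θ₂.relabel (Sum.elim Sum.inr fun j => Sum.inl (Sum.inr (Sum.inl j))) ⊔
      θ₃.relabel (Sum.elim Sum.inr fun j => Sum.inl (Sum.inr (Sum.inr j)))))

theorem realize_inclusionFormula {L : FirstOrder.Language.{u, v}} {M : Type*} [L.Structure M]
    {n₁ n₂ n₃ : ℕ} (θ₁ : L.Formula (Fin 1 ⊕ Fin n₁)) (θ₂ : L.Formula (Fin 1 ⊕ Fin n₂))
    (θ₃ : L.Formula (Fin 1 ⊕ Fin n₃)) (z₁ : Fin n₁ → M) (z₂ : Fin n₂ → M) (z₃ : Fin n₃ → M) :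
    (inclusionFormula θ₁ θ₂ θ₃).Realize (Sum.elim z₁ (Sum.elim z₂ z₃)) ↔
      fiber θ₁ z₁ ⊆ fiber θ₂ z₂ ∪ fiber θ₃ z₃ := by
  have hlab : ∀ {n : ℕ} (θ : L.Formula (Fin 1 ⊕ Fin n)) (s : Fin n → Fin n₁ ⊕ (Fin n₂ ⊕ Fin n₃))
      (z : Fin n₁ ⊕ (Fin n₂ ⊕ Fin n₃) → M) (x : Fin 1 → M),
      (θ.relabel (Sum.elim Sum.inr fun j => Sum.inl (s j))).Realize (Sum.elim z x) ↔
        x 0 ∈ fiber θ (z ∘ s) := by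
    intro n θ s z x
    rw [Formula.realize_relabel]
    change _ ↔ θ.Realize _
    refine iff_of_eq (congrArg (fun t => θ.Realize t) ?_)
    funext c
    rcases c with c | c
    · simp [Subsingleton.elim c 0]
    · simp
  simp only [inclusionFormula, Formula.realize_iAlls, Formula.realize_imp, Formula.realize_sup,
    hlab]
  exact ⟨fun h x hx => h (fun _ => x) hx, fun h x hx => h hx⟩

/-! ### The counting measure on `G` and its relation to genericity. -/

section Measure

variable {L : FirstOrder.Language.{u, v}} {mulSym : L.Functions 2} {ι : Type w} {U : Ultrafilter ι}
  {A : ι → Type w'} [∀ i, Group (A i)] [∀ i, L.Structure (A i)] {G : Type w''} [L.Structure G]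
  [(countLang L).Structure G]

/-- `G ⊨ [μ_θ ≤ q](b̄)`, where `φ(x) = θ(x; b̄)`. -/
def CountLE (φ : ParamFormula L G (Fin 1)) (q : ℚ) : Prop :=
  RelMap (L := countLang L) (M := G) (n := φ.n) (⟨1, φ.form⟩, q) φ.par

/-- In `G` the symbols `[μ_θ ≤ q]` are bare predicates; even their monotonicity in `q` must be
transferred. -/
theorem CountLE.mono (hext : IsElementaryExtensionOfUltraproduct L U A G)
    {φ : ParamFormula L G (Fin 1)} {q r : ℚ} (h : CountLE φ q) (hqr : q ≤ r) : CountLE φ r := by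
  have key := realize_of_forall_finite hext
    ((countAtom φ.form q id).imp (countAtom φ.form r id)) (by
      intro i z
      let := countStructure L (A i)
      rw [Formula.realize_imp, realize_countAtom, realize_countAtom]
      intro hz
      exact (relMap_countStructure φ.form r _).2
        (((relMap_countStructure φ.form q _).1 hz).trans hqr)) φ.par
  rw [Formula.realize_imp, realize_countAtom, realize_countAtom] at key
  exact key h

variable [∀ i, Finite (A i)]

theorem countLE_one (hext : IsElementaryExtensionOfUltraproduct L U A G)
    (φ : ParamFormula L G (Fin 1)) : CountLE φ 1 := by
  refine (realize_countAtom φ.form 1 id φ.par).1 (realize_of_forall_finite hext _ ?_ _)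
  intro i z
  let := countStructure L (A i)
  rw [realize_countAtom]
  refine (relMap_countStructure φ.form 1 _).2 ?_
  refine div_le_one_of_le₀ ?_ (by positivity)
  exact_mod_cast Nat.card_le_card_of_injective _ Subtype.val_injective

/-- Turns positivity of a real infimum into the failure of a single atomic `L⁺`-formula, which can
be transferred. -/
theorem mu_pos_iff (hext : IsElementaryExtensionOfUltraproduct L U A G)
    (φ : ParamFormula L G (Fin 1)) : 0 < mu φ ↔ ∃ q : ℚ, 0 < q ∧ ¬ CountLE φ q := by
  set S : Set ℝ := {r : ℝ | ∃ q : ℚ, r = q ∧ CountLE φ q} with hS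
  change 0 < sInf S ↔ _
  constructor
  · intro h
    have hbdd : BddBelow S := by
      -- The real `sInf` of a set unbounded below is `0`.
      by_contra hb
      rw [Real.sInf_of_not_bddBelow hb] at h
      exact lt_irrefl _ h
    obtain ⟨q, hq0, hq⟩ := exists_rat_btwn h
    refine ⟨q, by exact_mod_cast hq0, fun hc => ?_⟩
    exact absurd (csInf_le hbdd ⟨q, rfl, hc⟩) (not_le.2 hq)
  · rintro ⟨q, hq0, hq⟩
    refine lt_of_lt_of_le (b := (q : ℝ)) (by exact_mod_cast hq0)
      (le_csInf ⟨_, 1, rfl, countLE_one hext φ⟩ ?_)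
    rintro _ ⟨r, rfl, hr⟩
    by_contra hlt
    push Not at hlt
    exact hq (hr.mono hext (by exact_mod_cast hlt.le))

/-- Null sets are closed under finite unions and subsets. -/
theorem mu_pos_or_of_subset_union (hext : IsElementaryExtensionOfUltraproduct L U A G)
    {φ ψ χ : ParamFormula L G (Fin 1)} (hsub : φ.set ⊆ ψ.set ∪ χ.set) (hφ : 0 < mu φ) :
    0 < mu ψ ∨ 0 < mu χ := by
  rw [mu_pos_iff hext] at hφ ⊢
  rw [mu_pos_iff hext]
  obtain ⟨q, hq0, hq⟩ := hφ
  by_contra! hcon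
  have hψ := hcon.1 (q / 2) (by linarith)
  have hχ := hcon.2 (q / 2) (by linarith)
  -- The inclusion is known only in `G`, so it enters the transferred formula as a premise.
  have key := realize_of_forall_finite hext
    ((liftFormula (inclusionFormula φ.form ψ.form χ.form)).imp
      ((countAtom ψ.form (q / 2) fun j => Sum.inr (Sum.inl j)).imp
        ((countAtom χ.form (q / 2) fun j => Sum.inr (Sum.inr j)).imp
          (countAtom φ.form q Sum.inl)))) (by
      intro i z
      obtain ⟨z₁, z₂, z₃, rfl⟩ : ∃ z₁ z₂ z₃, z = Sum.elim z₁ (Sum.elim z₂ z₃) :=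
        ⟨fun j => z (Sum.inl j), fun j => z (Sum.inr (Sum.inl j)),
          fun j => z (Sum.inr (Sum.inr j)), by funext c; rcases c with c | c | c <;> rfl⟩
      simp only [Formula.realize_imp, realize_liftFormula, realize_countAtom,
        realize_inclusionFormula]
      intro h₁ h₂ h₃
      replace h₂ := (relMap_countStructure ψ.form _ z₂).1 h₂
      replace h₃ := (relMap_countStructure χ.form _ z₃).1 h₃
      refine (relMap_countStructure φ.form _ z₁).2 ?_
      have hcard : Nat.card (fiber φ.form z₁) ≤
          Nat.card (fiber ψ.form z₂) + Nat.card (fiber χ.form z₃) := by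
        simp only [Nat.card_coe_set_eq]
        exact (Set.ncard_le_ncard h₁ (Set.toFinite _)).trans (Set.ncard_union_le _ _)
      have hcard' : (Nat.card (fiber φ.form z₁) : ℚ) ≤
          Nat.card (fiber ψ.form z₂) + Nat.card (fiber χ.form z₃) := by exact_mod_cast hcard
      calc (Nat.card (fiber φ.form z₁) : ℚ) / Nat.card (A i)
          ≤ (Nat.card (fiber ψ.form z₂) + Nat.card (fiber χ.form z₃)) / Nat.card (A i) := by
            gcongr
        _ ≤ q := by rw [add_div]; linarith) (Sum.elim φ.par (Sum.elim ψ.par χ.par))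
  simp only [Formula.realize_imp, realize_liftFormula, realize_countAtom,
    realize_inclusionFormula] at key
  exact hq (key hsub hψ hχ)

/-- If an `L`-formula bounds the measure from below by `1 / N` in the finite structures, then it
implies positive measure in `G`. -/
theorem mu_pos_of_realize (hext : IsElementaryExtensionOfUltraproduct L U A G)
    {φ : ParamFormula L G (Fin 1)} (χ : L.Formula (Fin φ.n)) (hχ : χ.Realize φ.par) {N : ℕ}
    (hN : 1 ≤ N)
    (h : ∀ i (z : Fin φ.n → A i), χ.Realize z → Nat.card (A i) ≤ N * Nat.card (fiber φ.form z)) :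
    0 < mu φ := by
  have hN' : (0 : ℚ) < N := by exact_mod_cast hN
  -- A density of exactly `1 / N` may occur, and the atomic formula must fail; hence `1 / (2 * N)`.
  refine (mu_pos_iff hext φ).2 ⟨1 / (2 * N), by positivity, ?_⟩
  have key := realize_of_forall_finite hext
    ((liftFormula χ).imp (countAtom φ.form (1 / (2 * N)) id).not) (by
      intro i z
      simp only [Formula.realize_imp, Formula.realize_not, realize_liftFormula, realize_countAtom]
      intro hz hcount
      have h₁ := (relMap_countStructure φ.form _ z).1 hcount
      have hpos : (0 : ℚ) < Nat.card (A i) := by exact_mod_cast Nat.card_pos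
      have h₂ : (Nat.card (A i) : ℚ) ≤ N * Nat.card (fiber φ.form z) := by
        exact_mod_cast h i z hz
      rw [div_le_div_iff₀ hpos (by positivity)] at h₁
      nlinarith) φ.par
  simp only [Formula.realize_imp, Formula.realize_not, realize_liftFormula,
    realize_countAtom] at key
  exact key hχ

variable [Group G]

/-- An `L`-formula implied, in the finite structures, by large measure and NIP holds in `G` for
parameters giving positive measure and NIP. -/
theorem realize_of_not_countLE (hA : ∀ i, InterpretsMul mulSym (A i))
    (hG : InterpretsMul mulSym G) (hext : IsElementaryExtensionOfUltraproduct L U A G)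
    {φ : ParamFormula L G (Fin 1)} {q : ℚ} (hq : ¬ CountLE φ q) {k : ℕ}
    (hk : RelNIP k fun x y : G => y * x ∈ φ.set) (χ : L.Formula (Fin φ.n))
    (h : ∀ i (z : Fin φ.n → A i), RelNIP k (fun x y : A i => y * x ∈ fiber φ.form z) →
      q * Nat.card (A i) ≤ Nat.card (fiber φ.form z) → χ.Realize z) : χ.Realize φ.par := by
  -- NIP may fail in `A i` for some parameters. Since shattering of `k` points is first-order, it is
  -- added as an alternative.
  have key := realize_of_forall_finite hext
    (liftFormula (shatterFormula mulSym k φ.form ⊔ χ) ⊔ countAtom φ.form q id) (by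
      intro i z
      simp only [Formula.realize_sup, realize_liftFormula, realize_countAtom,
        realize_shatterFormula (hA i)]
      by_contra! hcon
      obtain ⟨⟨h₁, h₂⟩, h₃⟩ := hcon
      have h₄ : ¬ (Nat.card (fiber φ.form z) : ℚ) / Nat.card (A i) ≤ q :=
        fun h => h₃ ((relMap_countStructure φ.form q z).2 h)
      rw [not_le, lt_div_iff₀ (by exact_mod_cast Nat.card_pos)] at h₄
      exact h₂ (h i z h₁ h₄.le)) φ.par
  simp only [Formula.realize_sup, realize_liftFormula, realize_countAtom,
    realize_shatterFormula hG] at key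
  rcases key with (h₁ | h₁) | h₁
  · exact absurd hk h₁
  · exact h₁
  · exact absurd h₁ hq

theorem isRightGeneric_of_mu_pos (hA : ∀ i, InterpretsMul mulSym (A i))
    (hG : InterpretsMul mulSym G) (hext : IsElementaryExtensionOfUltraproduct L U A G)
    {φ : ParamFormula L G (Fin 1)} {k : ℕ} (hk : RelNIP k fun x y : G => y * x ∈ φ.set)
    (hφ : 0 < mu φ) : IsRightGeneric φ.set := by
  obtain ⟨q, hq0, hq⟩ := (mu_pos_iff hext φ).1 hφ
  obtain ⟨N, hN, h⟩ := exists_rightCover_bound.{w'} k hq0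
  refine isRightGeneric_iff.2 ⟨N, hN, (realize_rightCover hG N φ.form φ.par).1 ?_⟩
  exact realize_of_not_countLE hA hG hext hq hk _ fun i z h₁ h₂ =>
    (realize_rightCover (hA i) N φ.form z).2 (h _ _ h₁ h₂)

theorem isLeftGeneric_of_mu_pos (hA : ∀ i, InterpretsMul mulSym (A i))
    (hG : InterpretsMul mulSym G) (hext : IsElementaryExtensionOfUltraproduct L U A G)
    {φ : ParamFormula L G (Fin 1)} {k : ℕ} (hk : RelNIP k fun x y : G => y * x ∈ φ.set)
    (hφ : 0 < mu φ) : IsLeftGeneric φ.set := by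
  obtain ⟨q, hq0, hq⟩ := (mu_pos_iff hext φ).1 hφ
  obtain ⟨N, hN, h⟩ := exists_leftCover_bound.{w'} k hq0
  refine isLeftGeneric_iff.2 ⟨N, hN, (realize_leftCover hG N φ.form φ.par).1 ?_⟩
  exact realize_of_not_countLE hA hG hext hq hk _ fun i z h₁ h₂ =>
    (realize_leftCover (hA i) N φ.form z).2 (h _ _ h₁ h₂)

theorem mu_pos_of_isRightGeneric (hA : ∀ i, InterpretsMul mulSym (A i))
    (hG : InterpretsMul mulSym G) (hext : IsElementaryExtensionOfUltraproduct L U A G)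
    {φ : ParamFormula L G (Fin 1)} (hφ : IsRightGeneric φ.set) : 0 < mu φ := by
  obtain ⟨N, hN, h⟩ := isRightGeneric_iff.1 hφ
  refine mu_pos_of_realize hext (rightCover mulSym N φ.form)
    ((realize_rightCover hG N φ.form φ.par).2 h) hN fun i z hz => ?_
  obtain ⟨g, hg⟩ := (realize_rightCover (hA i) N φ.form z).1 hz
  exact card_le_mul_of_cover _ (fun j => Equiv.mulRight (g j)) hg

theorem mu_pos_of_isLeftGeneric (hA : ∀ i, InterpretsMul mulSym (A i))
    (hG : InterpretsMul mulSym G) (hext : IsElementaryExtensionOfUltraproduct L U A G)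
    {φ : ParamFormula L G (Fin 1)} (hφ : IsLeftGeneric φ.set) : 0 < mu φ := by
  obtain ⟨N, hN, h⟩ := isLeftGeneric_iff.1 hφ
  refine mu_pos_of_realize hext (leftCover mulSym N φ.form)
    ((realize_leftCover hG N φ.form φ.par).2 h) hN fun i z hz => ?_
  obtain ⟨g, hg⟩ := (realize_leftCover (hA i) N φ.form z).1 hz
  exact card_le_mul_of_cover _ (fun j => Equiv.mulLeft (g j)) hg

end Measure

/-! ### Semantics of formulas with parameters -/

namespace ParamFormula

variable {L : FirstOrder.Language.{u, v}} {G : Type w} [L.Structure G] {α : Type}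

theorem set_neg (φ : ParamFormula L G (Fin 1)) : φ.neg.set = φ.setᶜ := rfl

theorem holds_inst {k : ℕ} (δ : ParamFormula L G (α ⊕ Fin k)) (b : Fin k → G) (a : α → G) :
    (δ.inst b).Holds a ↔ δ.Holds (Sum.elim a b) := by
  rw [Holds, inst, Formula.realize_relabel, Holds]
  refine iff_of_eq (congrArg (fun t => δ.form.Realize t) ?_)
  funext c
  rcases c with (c | c) | c <;> simp

theorem mem_set_inst {k : ℕ} (δ : ParamFormula L G (Fin 1 ⊕ Fin k)) (b : Fin k → G) (x : G) :
    x ∈ (δ.inst b).set ↔ δ.Holds (Sum.elim (fun _ => x) b) :=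
  holds_inst δ b _

theorem realize_relabel_append (φ ψ : ParamFormula L G α) (a : α → G) :
    ((φ.form.relabel (Sum.map id (Fin.castAdd ψ.n))).Realize
      (Sum.elim a (Fin.append φ.par ψ.par)) ↔ φ.Holds a) ∧
    ((ψ.form.relabel (Sum.map id (Fin.natAdd φ.n))).Realize
      (Sum.elim a (Fin.append φ.par ψ.par)) ↔ ψ.Holds a) := by
  constructor <;> rw [Formula.realize_relabel, Holds]
  · refine iff_of_eq (congrArg (fun t => φ.form.Realize t) ?_)
    funext c
    rcases c with c | c <;> simp
  · refine iff_of_eq (congrArg (fun t => ψ.form.Realize t) ?_)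
    funext c
    rcases c with c | c <;> simp

theorem set_conj (φ ψ : ParamFormula L G (Fin 1)) : (φ.conj ψ).set = φ.set ∩ ψ.set := by
  ext x
  exact Formula.realize_inf.trans (and_congr (realize_relabel_append φ ψ _).1
    (realize_relabel_append φ ψ _).2)

theorem set_disj (φ ψ : ParamFormula L G (Fin 1)) : (φ.disj ψ).set = φ.set ∪ ψ.set := by
  ext x
  exact Formula.realize_sup.trans (or_congr (realize_relabel_append φ ψ _).1
    (realize_relabel_append φ ψ _).2)

/-- Preimages commute with Boolean operations. Used with `f = id` to pass from `δ` to `δʳ`, and with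
multiplications to translate types. -/
theorem IsDeltaFormula.exists_set_eq_preimage {k l : ℕ} {δ : ParamFormula L G (Fin 1 ⊕ Fin k)}
    {δ' : ParamFormula L G (Fin 1 ⊕ Fin l)} {f : G → G}
    (hf : ∀ b, ∃ c, (δ'.inst c).set = f ⁻¹' (δ.inst b).set) {φ : ParamFormula L G (Fin 1)}
    (hφ : δ.IsDeltaFormula φ) : ∃ ψ, δ'.IsDeltaFormula ψ ∧ ψ.set = f ⁻¹' φ.set := by
  induction hφ with
  | inst b =>
    obtain ⟨c, hc⟩ := hf b
    exact ⟨_, .inst c, hc⟩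
  | neg _ ih =>
    obtain ⟨ψ, hψ, h⟩ := ih
    exact ⟨_, hψ.neg, by rw [set_neg, h, set_neg, Set.preimage_compl]⟩
  | conj _ _ ih₁ ih₂ =>
    obtain ⟨ψ₁, hψ₁, h₁⟩ := ih₁
    obtain ⟨ψ₂, hψ₂, h₂⟩ := ih₂
    exact ⟨_, hψ₁.conj hψ₂, by rw [set_conj, h₁, h₂, set_conj, Set.preimage_inter]⟩
  | disj _ _ ih₁ ih₂ =>
    obtain ⟨ψ₁, hψ₁, h₁⟩ := ih₁
    obtain ⟨ψ₂, hψ₂, h₂⟩ := ih₂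
    exact ⟨_, hψ₁.disj hψ₂, by rw [set_disj, h₁, h₂, set_disj, Set.preimage_union]⟩

variable [Group G] {mulSym : L.Functions 2}

theorem holds_left (hG : InterpretsMul mulSym G) (φ : ParamFormula L G (Fin 1)) (a b : Fin 1 → G) :
    (φ.left mulSym).Holds (Sum.elim a b) ↔ b 0 * a 0 ∈ φ.set := by
  rw [Holds, left, Formula.Realize, BoundedFormula.realize_subst]
  change _ ↔ φ.form.Realize _
  rw [Formula.Realize]
  refine iff_of_eq (congrArg (fun t => BoundedFormula.Realize φ.form t default) ?_)
  funext c
  cases c with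
  | inl c => simpa [Term.realize_functions_apply₂] using hG _ _
  | inr c => simp

theorem holds_right (hG : InterpretsMul mulSym G) {k : ℕ} (δ : ParamFormula L G (Fin 1 ⊕ Fin k))
    (x : G) (b : Fin (k + 1) → G) :
    (δ.right mulSym).Holds (Sum.elim (fun _ => x) b) ↔
      δ.Holds (Sum.elim (fun _ => x * b (Fin.last k)) fun j => b j.castSucc) := by
  rw [Holds, right, Formula.Realize, BoundedFormula.realize_subst, Holds, Formula.Realize]
  refine iff_of_eq (congrArg (fun t => BoundedFormula.Realize δ.form t default) ?_)
  funext c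
  rcases c with (c | c) | c
  · simpa [Term.realize_functions_apply₂] using hG _ _
  · simp
  · simp

theorem isNIP_left_iff (hG : InterpretsMul mulSym G) (φ : ParamFormula L G (Fin 1)) :
    (φ.left mulSym).IsNIP ↔ ∃ k, 1 ≤ k ∧ RelNIP k fun x y : G => y * x ∈ φ.set := by
  refine exists_congr fun k => and_congr_right fun _ => ?_
  change RelNIP k (fun a b : Fin 1 → G => (φ.left mulSym).Holds (Sum.elim a b)) ↔ _
  exact ⟨fun h => h.comap (fun x _ => x) (fun y _ => y) fun x y =>
      (holds_left hG φ (fun _ => x) fun _ => y).symm,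
    fun h => h.comap (fun a => a 0) (fun b => b 0) fun a b => holds_left hG φ a b⟩

/-- For an instance, `φˡ(x; y)` is `δ(y * x * u; b)`, which invariance rewrites as `δ(x * u; c)`
with `c` depending on `y`; a shattering for `φˡ` is thus one for `δ`. Disjunctions follow by De
Morgan. -/
theorem IsLeftInvariant.isNIP_left (hG : InterpretsMul mulSym G) {k : ℕ}
    {δ : ParamFormula L G (Fin 1 ⊕ Fin k)} (hinv : δ.IsLeftInvariant) (hδ : δ.IsNIP)
    {φ : ParamFormula L G (Fin 1)} (hφ : (δ.right mulSym).IsDeltaFormula φ) :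
    (φ.left mulSym).IsNIP := by
  rw [isNIP_left_iff hG]
  induction hφ with
  | inst b =>
    obtain ⟨l, hl, h⟩ := hδ
    choose c hc using hinv
    refine ⟨l, hl, ?_⟩
    have h' : RelNIP l fun (a : Fin 1 → G) (d : Fin k → G) => δ.Holds (Sum.elim a d) := h
    refine h'.comap (fun x _ => x * b (Fin.last k)) (fun y => c y fun j => b j.castSucc)
      fun x y => ?_
    rw [mem_set_inst, holds_right hG, ← hc, mul_assoc]
  | neg _ ih =>
    obtain ⟨l, hl, h⟩ := ih
    exact ⟨l, hl, h.not⟩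
  | conj _ _ ih₁ ih₂ =>
    obtain ⟨l₁, -, h₁⟩ := ih₁
    obtain ⟨l₂, -, h₂⟩ := ih₂
    simp only [set_conj]
    exact h₁.and h₂
  | disj _ _ ih₁ ih₂ =>
    obtain ⟨l₁, -, h₁⟩ := ih₁
    obtain ⟨l₂, -, h₂⟩ := ih₂
    obtain ⟨l, hl, h⟩ := h₁.not.and h₂.not
    refine ⟨l, hl, h.not.comap id id fun x y => ?_⟩
    simp only [set_disj, Set.mem_union, id]
    tauto

theorem exists_inst_right_set_eq (hG : InterpretsMul mulSym G) {k : ℕ}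
    (δ : ParamFormula L G (Fin 1 ⊕ Fin k)) (b : Fin k → G) :
    ∃ c, ((δ.right mulSym).inst c).set = id ⁻¹' (δ.inst b).set := by
  refine ⟨Fin.snoc (α := fun _ => G) b 1, ?_⟩
  ext x
  rw [mem_set_inst, holds_right hG, Set.preimage_id, mem_set_inst]
  simp

/-- Right multiplication only changes `u`; this is what `δʳ` gains over `δ`. -/
theorem exists_inst_right_mulRight (hG : InterpretsMul mulSym G) {k : ℕ}
    (δ : ParamFormula L G (Fin 1 ⊕ Fin k)) (g : G) (b : Fin (k + 1) → G) :
    ∃ c, ((δ.right mulSym).inst c).set =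
      (fun x => x * g) ⁻¹' ((δ.right mulSym).inst b).set := by
  refine ⟨Fin.snoc (α := fun _ => G) (fun j => b j.castSucc) (g * b (Fin.last k)), ?_⟩
  ext x
  rw [mem_set_inst, holds_right hG, Set.mem_preimage, mem_set_inst, holds_right hG]
  simp [mul_assoc]

theorem IsLeftInvariant.exists_inst_right_mulLeft (hG : InterpretsMul mulSym G) {k : ℕ}
    {δ : ParamFormula L G (Fin 1 ⊕ Fin k)} (hinv : δ.IsLeftInvariant) (g : G)
    (b : Fin (k + 1) → G) :
    ∃ c, ((δ.right mulSym).inst c).set =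
      (fun x => g * x) ⁻¹' ((δ.right mulSym).inst b).set := by
  obtain ⟨c, hc⟩ := hinv g fun j => b j.castSucc
  refine ⟨Fin.snoc (α := fun _ => G) c (b (Fin.last k)), ?_⟩
  ext x
  rw [mem_set_inst, holds_right hG, Set.mem_preimage, mem_set_inst, holds_right hG, mul_assoc, hc]
  simp

end ParamFormula

/-! ### Types -/

section Types

variable {L : FirstOrder.Language.{u, v}} {G : Type w} [L.Structure G] {k : ℕ}

/-- The instances of `δ` in an ultrafilter. -/
def ultrafilterType (δ : ParamFormula L G (Fin 1 ⊕ Fin k)) (F : Ultrafilter G) : Set (Set G) :=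
  {X | IsInstanceSet δ X ∧ X ∈ F}

theorem IsInstanceSet.compl {δ : ParamFormula L G (Fin 1 ⊕ Fin k)} {X : Set G}
    (h : IsInstanceSet δ X) : IsInstanceSet δ Xᶜ := by
  obtain ⟨b, rfl | rfl⟩ := h
  · exact ⟨b, Or.inr rfl⟩
  · exact ⟨b, Or.inl (by rw [ParamFormula.set_neg, compl_compl])⟩

/-- Maximality holds because an ultrafilter decides every instance: a larger family would contain
some `X` together with `Xᶜ`. -/
theorem ultrafilterType_mem_typeSpace (δ : ParamFormula L G (Fin 1 ⊕ Fin k)) (F : Ultrafilter G) :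
    ultrafilterType δ F ∈ typeSpace δ := by
  refine ⟨⟨fun X hX => hX.1, fun s hs hfin => ?_⟩, fun q hq hle X hX => ⟨hq.1 X hX, ?_⟩⟩
  · exact F.nonempty_of_mem ((Filter.sInter_mem hfin).2 fun X hX => (hs hX).2)
  · by_contra hXF
    have hc : Xᶜ ∈ q := hle ⟨(hq.1 X hX).compl, Ultrafilter.compl_mem_iff_notMem.2 hXF⟩
    obtain ⟨x, hx⟩ := hq.2 {X, Xᶜ} (by rintro Y (rfl | rfl) <;> assumption) (Set.toFinite _)
    exact hx Xᶜ (by simp) (hx X (by simp))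

theorem InType.mem_ultrafilter {δ : ParamFormula L G (Fin 1 ⊕ Fin k)} {F : Ultrafilter G}
    {φ : ParamFormula L G (Fin 1)} (h : InType φ (ultrafilterType δ F)) : φ.set ∈ F := by
  obtain ⟨s, hs, hfin, hsub⟩ := h
  exact Filter.mem_of_superset ((Filter.sInter_mem hfin).2 fun X hX => (hs hX).2) hsub

theorem IsConsistent.image_preimage {p : Set (Set G)} (hp : IsConsistent p) (e : G ≃ G) :
    IsConsistent ((fun X => e ⁻¹' X) '' p) := by
  intro s hs hfin
  obtain ⟨x, hx⟩ := hp ((fun X => e.symm ⁻¹' X) '' s) (by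
    rintro _ ⟨X, hX, rfl⟩
    obtain ⟨Y, hY, rfl⟩ := hs hX
    simpa [← Set.preimage_comp] using hY) (hfin.image _)
  exact ⟨e.symm x, fun X hX => hx _ ⟨X, hX, rfl⟩⟩

theorem image_preimage_mem_typeSpace {δ : ParamFormula L G (Fin 1 ⊕ Fin k)} {p : Set (Set G)}
    (hp : p ∈ typeSpace δ) (e : G ≃ G) (he : ∀ X, IsInstanceSet δ X → IsInstanceSet δ (e ⁻¹' X))
    (he' : ∀ X, IsInstanceSet δ X → IsInstanceSet δ (e.symm ⁻¹' X)) :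
    (fun X => e ⁻¹' X) '' p ∈ typeSpace δ := by
  refine ⟨⟨?_, hp.1.2.image_preimage e⟩, fun q hq hle X hX => ?_⟩
  · rintro _ ⟨X, hX, rfl⟩
    exact he X (hp.1.1 X hX)
  · have hq' : (fun X => e.symm ⁻¹' X) '' q ⊆ p := by
      refine hp.2 ⟨?_, hq.2.image_preimage e.symm⟩ fun Y hY => ?_
      · rintro _ ⟨X, hX, rfl⟩
        exact he' X (hq.1 X hX)
      · exact ⟨e ⁻¹' Y, hle ⟨Y, hY, rfl⟩, by simp [← Set.preimage_comp]⟩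
    exact ⟨e.symm ⁻¹' X, hq' ⟨X, hX, rfl⟩, by simp [← Set.preimage_comp]⟩

theorem InType.of_image_preimage {p : Set (Set G)} {e : G ≃ G} {φ ψ : ParamFormula L G (Fin 1)}
    (h : InType φ ((fun X => e ⁻¹' X) '' p)) (hψ : ψ.set = e.symm ⁻¹' φ.set) : InType ψ p := by
  obtain ⟨s, hs, hfin, hsub⟩ := h
  refine ⟨(fun X => e.symm ⁻¹' X) '' s, ?_, hfin.image _, fun x hx => ?_⟩
  · rintro _ ⟨X, hX, rfl⟩
    obtain ⟨Y, hY, rfl⟩ := hs hX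
    simpa [← Set.preimage_comp] using hY
  · rw [hψ]
    exact hsub fun X hX => hx _ ⟨X, hX, rfl⟩

theorem IsInstanceSet.preimage {δ : ParamFormula L G (Fin 1 ⊕ Fin k)} {f : G → G}
    (hf : ∀ b, ∃ c, (δ.inst c).set = f ⁻¹' (δ.inst b).set) {X : Set G} (hX : IsInstanceSet δ X) :
    IsInstanceSet δ (f ⁻¹' X) := by
  obtain ⟨b, rfl | rfl⟩ := hX <;> obtain ⟨c, hc⟩ := hf b
  · exact ⟨c, Or.inl hc.symm⟩
  · exact ⟨c, Or.inr (by rw [ParamFormula.set_neg, ParamFormula.set_neg, hc, Set.preimage_compl])⟩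

/-- The image of a left generic type under a permutation that preserves instances and left
genericity is a left generic type. -/
theorem isLeftGenericType_image_preimage [Group G] {δ : ParamFormula L G (Fin 1 ⊕ Fin k)}
    {p : Set (Set G)} (hp : p ∈ typeSpace δ) (hgen : IsLeftGenericType δ p) (e : G ≃ G)
    (he : ∀ b, ∃ c, (δ.inst c).set = e ⁻¹' (δ.inst b).set)
    (he' : ∀ b, ∃ c, (δ.inst c).set = e.symm ⁻¹' (δ.inst b).set)
    (htr : ∀ X : Set G, IsLeftGeneric (e.symm ⁻¹' X) → IsLeftGeneric X) :
    (fun X => e ⁻¹' X) '' p ∈ typeSpace δ ∧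
      IsLeftGenericType δ ((fun X => e ⁻¹' X) '' p) := by
  refine ⟨image_preimage_mem_typeSpace hp e (fun X hX => hX.preimage he)
    fun X hX => hX.preimage he', fun φ hφ hin => ?_⟩
  obtain ⟨ψ, hψ, hset⟩ := hφ.exists_set_eq_preimage he'
  exact htr _ (hset ▸ hgen ψ hψ (hin.of_image_preimage hset))

end Types

/-! ### Generic types -/

section GenericTypes

variable {L : FirstOrder.Language.{u, v}} {mulSym : L.Functions 2} {ι : Type w} {U : Ultrafilter ι}
  {A : ι → Type w'} [∀ i, Group (A i)] [∀ i, Finite (A i)] [∀ i, L.Structure (A i)]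
  {G : Type w''} [Group G] [L.Structure G] [(countLang L).Structure G]

theorem generic_iff_mu_pos (hA : ∀ i, InterpretsMul mulSym (A i)) (hG : InterpretsMul mulSym G)
    (hext : IsElementaryExtensionOfUltraproduct L U A G) {φ : ParamFormula L G (Fin 1)}
    (hφ : (φ.left mulSym).IsNIP) :
    (IsLeftGeneric φ.set ↔ IsRightGeneric φ.set) ∧ (IsRightGeneric φ.set ↔ 0 < mu φ) := by
  obtain ⟨k, -, hk⟩ := (ParamFormula.isNIP_left_iff hG φ).1 hφ
  have hr : IsRightGeneric φ.set ↔ 0 < mu φ :=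
    ⟨mu_pos_of_isRightGeneric hA hG hext, isRightGeneric_of_mu_pos hA hG hext hk⟩
  exact ⟨⟨fun h => hr.2 (mu_pos_of_isLeftGeneric hA hG hext h),
    fun h => isLeftGeneric_of_mu_pos hA hG hext hk (hr.1 h)⟩, hr⟩

/-- If every `δ`-formula of positive measure is nonempty, then some ultrafilter contains only
`δ`-formulas of positive measure. -/
theorem exists_ultrafilter_mu_pos (hA : ∀ i, InterpretsMul mulSym (A i))
    (hG : InterpretsMul mulSym G) (hext : IsElementaryExtensionOfUltraproduct L U A G) {k : ℕ}
    (δ : ParamFormula L G (Fin 1 ⊕ Fin k))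
    (hne : ∀ φ, δ.IsDeltaFormula φ → 0 < mu φ → φ.set.Nonempty) :
    ∃ F : Ultrafilter G, ∀ φ, δ.IsDeltaFormula φ → φ.set ∈ F → 0 < mu φ := by
  let 𝓒 : Set (Set G) := {X | ∃ φ, δ.IsDeltaFormula φ ∧ ¬ 0 < mu φ ∧ X = φ.setᶜ}
  -- Stronger than nonemptiness, so that induction works: removing a null set from a `δ`-formula of
  -- positive measure leaves positive measure.
  have key : ∀ t : Set (Set G), t.Finite → t ⊆ 𝓒 →
      ∃ χ, δ.IsDeltaFormula χ ∧ 0 < mu χ ∧ χ.set ⊆ ⋂₀ t := by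
    intro t ht
    induction t, ht using Set.Finite.induction_on with
    | empty =>
      intro _
      let φ := δ.inst fun _ => 1
      refine ⟨φ.disj φ.neg, .disj (.inst _) (.neg (.inst _)), ?_, by simp⟩
      refine mu_pos_of_isRightGeneric hA hG hext (isRightGeneric_iff.2 ⟨1, le_rfl, 1, fun x => ?_⟩)
      refine ⟨0, ?_⟩
      rw [ParamFormula.set_disj, ParamFormula.set_neg, Set.union_compl_self]
      trivial
    | insert _ _ ih =>
      intro hsub
      obtain ⟨χ, hχ, hpos, hχt⟩ := ih ((Set.subset_insert _ _).trans hsub)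
      obtain ⟨φ, hφ, hnull, rfl⟩ := hsub (Set.mem_insert _ _)
      refine ⟨χ.conj φ.neg, hχ.conj hφ.neg, ?_, ?_⟩
      · refine (mu_pos_or_of_subset_union hext (ψ := χ.conj φ.neg) (χ := φ) ?_ hpos).resolve_right
          hnull
        intro x hx
        rw [ParamFormula.set_conj, ParamFormula.set_neg]
        by_cases h : x ∈ φ.set
        · exact Or.inr h
        · exact Or.inl ⟨hx, h⟩
      · rw [ParamFormula.set_conj, ParamFormula.set_neg, Set.sInter_insert]
        exact fun x hx => ⟨hx.2, hχt hx.1⟩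
  have hbot : (Filter.generate 𝓒).NeBot := by
    rw [Filter.generate_neBot_iff]
    intro t ht hfin
    obtain ⟨χ, hχ, hpos, hsub⟩ := key t hfin ht
    exact (hne χ hχ hpos).mono hsub
  refine ⟨Ultrafilter.of (Filter.generate 𝓒), fun φ hφ hmem => ?_⟩
  by_contra hnull
  have hc : φ.setᶜ ∈ Ultrafilter.of (Filter.generate 𝓒) :=
    Ultrafilter.of_le _ (Filter.mem_generate_of_mem ⟨φ, hφ, hnull, rfl⟩)
  exact Ultrafilter.compl_mem_iff_notMem.1 hc hmem

end GenericTypes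

end PseudofiniteNIP

theorem proposition3p12
    {L : FirstOrder.Language} (mulSym : L.Functions 2)
    {ι : Type*} (U : Ultrafilter ι)
    (A : ι → Type*) [∀ i, Group (A i)] [∀ i, Finite (A i)] [∀ i, L.Structure (A i)]
    (hA : ∀ i, InterpretsMul mulSym (A i))
    {G : Type*} [Group G] [L.Structure G] [(countLang L).Structure G]
    (hG : InterpretsMul mulSym G)
    (hext : IsElementaryExtensionOfUltraproduct L U A G) :
    (∀ φ : ParamFormula L G (Fin 1), (φ.left mulSym).IsNIP →
      (IsLeftGeneric φ.set ↔ IsRightGeneric φ.set) ∧ (IsRightGeneric φ.set ↔ 0 < mu φ)) ∧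
    (∀ (k : ℕ) (δ : ParamFormula L G (Fin 1 ⊕ Fin k)), δ.IsLeftInvariant → δ.IsNIP →
      (∀ φ, (δ.right mulSym).IsDeltaFormula φ → (φ.left mulSym).IsNIP) ∧
      (∀ φ, (δ.right mulSym).IsDeltaFormula φ →
        (IsLeftGeneric φ.set ↔ IsRightGeneric φ.set) ∧ (IsRightGeneric φ.set ↔ 0 < mu φ)) ∧
      (∀ p ∈ typeSpace (δ.right mulSym),
        (IsLeftGenericType (δ.right mulSym) p ↔ IsRightGenericType (δ.right mulSym) p) ∧
        (IsRightGenericType (δ.right mulSym) p ↔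
          ∀ φ, (δ.right mulSym).IsDeltaFormula φ → InType φ p → 0 < mu φ)) ∧
      (∃ p ∈ typeSpace (δ.right mulSym), IsLeftGenericType (δ.right mulSym) p) ∧
      (∃ p ∈ typeSpace δ, IsLeftGenericType δ p ∧ IsRightGenericType δ p) ∧
      (∀ p ∈ typeSpace (δ.right mulSym), IsLeftGenericType (δ.right mulSym) p → ∀ g : G,
        (leftTranslate g p ∈ typeSpace (δ.right mulSym) ∧
          IsLeftGenericType (δ.right mulSym) (leftTranslate g p)) ∧
        (rightTranslate p g ∈ typeSpace (δ.right mulSym) ∧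
          IsLeftGenericType (δ.right mulSym) (rightTranslate p g)))) := by
  refine ⟨fun φ hφ => generic_iff_mu_pos hA hG hext hφ, fun k δ hinv hδ => ?_⟩
  have hnip : ∀ φ, (δ.right mulSym).IsDeltaFormula φ → (φ.left mulSym).IsNIP :=
    fun φ hφ => hinv.isNIP_left hG hδ hφ
  have hgen : ∀ φ, (δ.right mulSym).IsDeltaFormula φ →
      (IsLeftGeneric φ.set ↔ IsRightGeneric φ.set) ∧ (IsRightGeneric φ.set ↔ 0 < mu φ) :=
    fun φ hφ => generic_iff_mu_pos hA hG hext (hnip φ hφ)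
  obtain ⟨F, hF⟩ := exists_ultrafilter_mu_pos hA hG hext (δ.right mulSym) (by
    intro φ hφ hpos
    obtain ⟨N, -, g, hg⟩ := isRightGeneric_iff.1 ((hgen φ hφ).2.2 hpos)
    obtain ⟨i, hi⟩ := hg 1
    exact ⟨_, hi⟩)
  refine ⟨hnip, hgen, fun p _ => ⟨?_, ?_⟩, ?_, ?_, ?_⟩
  · exact forall₃_congr fun φ hφ _ => (hgen φ hφ).1
  · exact forall₃_congr fun φ hφ _ => (hgen φ hφ).2
  · refine ⟨_, ultrafilterType_mem_typeSpace (δ.right mulSym) F, fun φ hφ hin => ?_⟩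
    exact (hgen φ hφ).1.2 ((hgen φ hφ).2.2 (hF φ hφ hin.mem_ultrafilter))
  -- The same ultrafilter serves for `δ`, since every `δ`-formula is equivalent to a `δʳ`-formula,
  -- with `u = 1`.
  · have hboth : ∀ φ, δ.IsDeltaFormula φ → InType φ (ultrafilterType δ F) →
        IsLeftGeneric φ.set ∧ IsRightGeneric φ.set := by
      intro φ hφ hin
      obtain ⟨ψ, hψ, hset⟩ := hφ.exists_set_eq_preimage
        (ParamFormula.exists_inst_right_set_eq (mulSym := mulSym) hG δ)
      rw [Set.preimage_id] at hset
      have hmem := hin.mem_ultrafilter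
      rw [← hset] at hmem ⊢
      have hr := (hgen ψ hψ).2.2 (hF ψ hψ hmem)
      exact ⟨(hgen ψ hψ).1.2 hr, hr⟩
    exact ⟨_, ultrafilterType_mem_typeSpace δ F, fun φ hφ hin => (hboth φ hφ hin).1,
      fun φ hφ hin => (hboth φ hφ hin).2⟩
  · intro p hp hpgen g
    constructor
    -- The members of `gp` are preimages under multiplication by `g⁻¹`, hence the inverse
    -- permutation.
    · refine isLeftGenericType_image_preimage hp hpgen (Equiv.mulLeft g).symm
        (fun b => ?_) (fun b => ?_) fun X hX => hX.of_left_translate g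
      · exact hinv.exists_inst_right_mulLeft hG g⁻¹ b
      · exact hinv.exists_inst_right_mulLeft hG g b
    · refine isLeftGenericType_image_preimage hp hpgen (Equiv.mulRight g).symm
        (fun b => ?_) (fun b => ?_) fun X hX => hX.of_right_translate g
      · exact ParamFormula.exists_inst_right_mulRight hG δ g⁻¹ b
      · exact ParamFormula.exists_inst_right_mulRight hG δ g b
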